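/- Let $G=\mathrm{GL}(n,\mathbb C)$, regarded as a real Lie group, $\mathcal G=\mathrm{gl}(n,\mathbb C)$ its real Lie algebra with the trace form $\langle X,Y\rangle=\mathrm{Re}\,\mathrm{tr}(XY)$, and $\mathfrak M=G\times\mathcal G$, a smooth real manifold. Write $X=X_>+X_0+X_<$ for the decomposition of $X\in\mathcal G$ into strictly upper triangular, diagonal and strictly lower triangular parts, and put $r(X)=\frac12(X_>-X_<)$, $r_\pm=r\pm\frac12\mathrm{id}$. For $F\in C^\infty(\mathfrak M,\mathbb R)$ define $\mathcal G$-valued derivatives by requiring, for all $X\in\mathcal G$, $$\langle\nabla_1F(g,J),X\rangle=\tfrac{d}{dt}\Big|_{t=0}F(e^{tX}g,J),\quad \langle\nabla_1'F(g,J),X\rangle=\tfrac{d}{dt}\Big|_{t=0}F(ge^{tX},J),\quad \langle d_2F(g,J),X\rangle=\tfrac{d}{dt}\Big|_{t=0}F(g,J+tX),$$ and set $\nabla_2F(g,J)=J\,d_2F(g,J)$, $\nabla_2'F(g,J)=d_2F(g,J)\,J$. These derivatives exist, and the following hold. 1. The two formulas $$\{F,H\}_1(g,J)=\langle\nabla_1F,d_2H\rangle-\langle\nabla_1H,d_2F\rangle+\langle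 J,[d_2F,d_2H]\rangle,$$ $$\{F,H\}_2(g,J)=\langle r\nabla_1F,\nabla_1H\rangle-\langle r\nabla_1'F,\nabla_1'H\rangle+\langle\nabla_2F-\nabla_2'F,\,r_+\nabla_2'H-r_-\nabla_2H\rangle+\langle\nabla_1F,\,r_+\nabla_2'H-r_-\nabla_2H\rangle-\langle\nabla_1H,\,r_+\nabla_2'F-r_-\nabla_2F\rangle$$ (all derivatives taken at $(g,J)$) define two Poisson brackets on $C^\infty(\mathfrak M,\mathbb R)$: each maps pairs of smooth functions to smooth functions, is $\mathbb R$-bilinear and antisymmetric, and satisfies the Leibniz rule and the Jacobi identity. 2. The first bracket is the canonical one of $T^*G$ in right trivialization: the map $\Phi:\mathfrak M\to T^*G$ sending $(g,J)$ to the covector $v\mapsto\langle J,vg^{-1}\rangle$ at $g$ is a diffeomorphism, and $\{f\circ\Phi,h\circ\Phi\}_1=\{f,h\}_{\mathrm{can}}\circ\Phi$ for all $f,h\in C^\infty(T^*G,\mathbb R)$. Here $\{f,h\}_{\mathrm{can}}=\omega(\xi_f,\xi_h)$, where $\omega=-d\theta$, $\theta$ is the Liouville form, and $\omega(\xi_f,\cdot)=df$.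 3. The second bracket is quadratic: if $F$ and $H$ are restrictions to $\mathfrak M$ of real linear functionals on $\mathcal G\times\mathcal G$, then $\{F,H\}_2$ is the restriction of a real quadratic form on $\mathcal G\times\mathcal G$. 4. Near the identity the second bracket is transferred from the Heisenberg double. On $\mathcal G\oplus\mathcal G$ let $\langle(X_1,X_2),(Y_1,Y_2)\rangle_2=\langle X_1,Y_1\rangle-\langle X_2,Y_2\rangle$ and $\rho=\frac12(P_\delta-P_*)$, where $P_\delta,P_*$ are the projections belonging to the direct sum decomposition $\mathcal G\oplus\mathcal G=\{(X,X)\}+\{(r_+X,r_-X)\}$. For a smooth real function $\mathcal F$ on an open subset of $G\times G$ let $\langle\mathcal D\mathcal F,(X_1,X_2)\rangle_2=\frac{d}{dt}\big|_{0}\mathcal F(e^{tX_1}g_1,e^{tX_2}g_2)$ and $\langle\mathcal D'\mathcal F,(X_1,X_2)\rangle_2=\frac{d}{dt}\big|_{0}\mathcal F(g_1e^{tX_1},g_2e^{tX_2})$, and put $\{\mathcal F,\mathcal H\}_+=\langle\mathcal D\mathcal F,\rho\mathcal D\mathcal H\rangle_2+\langle\mathcal D'\mathcal F,\rho\mathcal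 D'\mathcal H\rangle_2$. Let $G^*$ be the set of all $\eta_*=(\eta_>\eta_0,(\eta_0\eta_<)^{-1})$ with $\eta_>$ upper unitriangular, $\eta_0$ invertible diagonal and $\eta_<$ lower unitriangular. Then there is a diffeomorphism $\psi$ from an open neighbourhood of $(\mathbf 1,\mathbf 1)$ in $G\times G$ onto an open neighbourhood of $(\mathbf 1,\mathbf 1)$ in $\mathfrak M$, with $\psi(\mathbf 1,\mathbf 1)=(\mathbf 1,\mathbf 1)$, such that for every $(g_1,g_2)$ in its domain, $\psi(g_1,g_2)=(g,J)$ satisfies $$(g_1,g_2)=(g_L,g_L)\,\eta_{*R}^{-1}=\eta_{*L}\,(g,g)^{-1},\qquad J=\eta_>\eta_0^2\eta_<,$$ for some $g_L\in G$, $\eta_{*R}=(\eta_>\eta_0,(\eta_0\eta_<)^{-1})\in G^*$ and $\eta_{*L}\in G^*$; and for all smooth real functions $F,H$ on the image of $\psi$ one has $\{F,H\}_2\circ\psi=\{F\circ\psi,H\circ\psi\}_+$. -/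

import Mathlib

open scoped Manifold ContDiff Matrix.Norms.L2Operator

noncomputable section

namespace BiHam

/-- The real Lie algebra `gl(n,ℂ)`; the (auxiliary) norm only serves to give it its usual topology
and smooth structure. -/
abbrev Mat (n : ℕ) : Type := Matrix (Fin n) (Fin n) ℂ

/-- The manifold `M = GL(n,ℂ) × gl(n,ℂ)`. -/
abbrev M (n : ℕ) : Type := GL (Fin n) ℂ × Mat n

/-- The *real* model of `GL(n,ℂ) × gl(n,ℂ)` as a smooth manifold. -/
abbrev IM (n : ℕ) := (𝓘(ℝ, Mat n)).prod 𝓘(ℝ, Mat n)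

/-- The real algebra `C^∞(M, ℝ)`. -/
abbrev SmoothFn (n : ℕ) : Type := C^∞⟮IM n, M n; ℝ⟯

/-! ### Poisson brackets -/

/-- A Poisson bracket on a commutative algebra: a bilinear bracket that is antisymmetric, satisfies
the Leibniz rule, and satisfies the Jacobi identity. -/
structure IsPoissonBracket {A : Type*} [CommRing A] [Algebra ℝ A] (B : A →ₗ[ℝ] A →ₗ[ℝ] A) :
    Prop where
  antisymm : ∀ f h, B f h = -B h f
  leibniz : ∀ f h k, B f (h * k) = B f h * k + h * B f k
  jacobi : ∀ f h k, B f (B h k) + B h (B k f) + B k (B f h) = 0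

/-! ### The trace form, the r-matrix, and derivatives -/

variable {n : ℕ}

/-- `⟨X, Y⟩ = Re tr (X Y)`. -/
def pairing (X Y : Mat n) : ℝ := (X * Y).trace.re

/-- `r(X) = (X_> - X_<) / 2`, with `X_>` and `X_<` the strictly upper and lower triangular parts. -/
def r (X : Mat n) : Mat n := Matrix.of fun i j =>
  if i < j then (1 / 2 : ℂ) * X i j else if j < i then -(1 / 2 : ℂ) * X i j else 0

/-- `r₊ = r + id / 2`. -/
def rPlus (X : Mat n) : Mat n := r X + (1 / 2 : ℝ) • X

/-- `r₋ = r - id / 2`. -/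
def rMinus (X : Mat n) : Mat n := r X - (1 / 2 : ℝ) • X

/-- The vector `Y` with `B Y X = φ X` for all `X`
(used for nondegenerate forms `B` and linear functionals `φ`). -/
def gradientWrt {V : Type*} [Nonempty V] (B : V → V → ℝ) (φ : V → ℝ) : V :=
  Classical.epsilon fun Y => ∀ X, B Y X = φ X

theorem gradientWrt_spec {V : Type*} [Nonempty V] {B : V → V → ℝ} {φ : V → ℝ}
    (h : ∃ Y, ∀ X, B Y X = φ X) (X : V) : B (gradientWrt B φ) X = φ X :=
  Classical.epsilon_spec (p := fun Y => ∀ X, B Y X = φ X) h X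

/-- The trace form is nondegenerate. -/
theorem pairing_left_injective {Y Y' : Mat n} (h : ∀ X, pairing Y X = pairing Y' X) : Y = Y' := by
  have key : ∀ (Z : Mat n) (i j : Fin n) (c : ℂ),
      pairing Z (Matrix.single j i c) = (Z i j * c).re := by
    intro Z i j c
    unfold pairing
    congr 1
    rw [Matrix.trace_mul_comm]
    simp [Matrix.trace_single_mul, mul_comm]
  ext i j
  apply Complex.ext
  · simpa [key] using h (Matrix.single j i 1)
  · simpa [key] using h (Matrix.single j i Complex.I)

/-- `e^X` as an element of `GL(n,ℂ)`. -/
def expGL (X : Mat n) : GL (Fin n) ℂ where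
  val := NormedSpace.exp X
  inv := NormedSpace.exp (-X)
  val_inv := by
    rw [← Matrix.exp_add_of_commute X (-X) (Commute.neg_right (Commute.refl X))]; simp
  inv_val := by
    rw [← Matrix.exp_add_of_commute (-X) X (Commute.neg_left (Commute.refl X))]; simp

/-- `⟨∇₁F(g,J), X⟩ = d/dt F(e^{tX} g, J)` at `t = 0`. -/
def nabla1 (F : M n → ℝ) (x : M n) : Mat n :=
  gradientWrt pairing fun X => deriv (fun t : ℝ => F (expGL (t • X) * x.1, x.2)) 0

/-- `⟨∇₁'F(g,J), X⟩ = d/dt F(g e^{tX}, J)` at `t = 0`. -/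
def nabla1' (F : M n → ℝ) (x : M n) : Mat n :=
  gradientWrt pairing fun X => deriv (fun t : ℝ => F (x.1 * expGL (t • X), x.2)) 0

/-- `⟨d₂F(g,J), X⟩ = d/dt F(g, J + tX)` at `t = 0`. -/
def d2 (F : M n → ℝ) (x : M n) : Mat n :=
  gradientWrt pairing fun X => deriv (fun t : ℝ => F (x.1, x.2 + t • X)) 0

/-- `∇₂F(g,J) = J d₂F(g,J)`. -/
def nabla2 (F : M n → ℝ) (x : M n) : Mat n := x.2 * d2 F x

/-- `∇₂'F(g,J) = d₂F(g,J) J`. -/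
def nabla2' (F : M n → ℝ) (x : M n) : Mat n := d2 F x * x.2

/-- The formula of the first bracket. -/
def bracket1 (F H : M n → ℝ) (x : M n) : ℝ :=
  pairing (nabla1 F x) (d2 H x) - pairing (nabla1 H x) (d2 F x)
    + pairing x.2 (d2 F x * d2 H x - d2 H x * d2 F x)

/-- The formula of the second bracket. -/
def bracket2 (F H : M n → ℝ) (x : M n) : ℝ :=
  pairing (r (nabla1 F x)) (nabla1 H x) - pairing (r (nabla1' F x)) (nabla1' H x)
    + pairing (nabla2 F x - nabla2' F x) (rPlus (nabla2' H x) - rMinus (nabla2 H x))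
    + pairing (nabla1 F x) (rPlus (nabla2' H x) - rMinus (nabla2 H x))
    - pairing (nabla1 H x) (rPlus (nabla2' F x) - rMinus (nabla2 F x))

/-! ### The cotangent bundle of `GL(n,ℂ)` and its canonical Poisson bracket -/

/-- `T^*GL(n,ℂ)`. Since `GL(n,ℂ)` is open in `gl(n,ℂ)`, each of its (real) tangent spaces is
`gl(n,ℂ)`, and a covector at `g` is a real linear functional on `gl(n,ℂ)`. -/
abbrev CotangentGL (n : ℕ) : Type := GL (Fin n) ℂ × (Mat n →L[ℝ] ℝ)

abbrev ICot (n : ℕ) := (𝓘(ℝ, Mat n)).prod 𝓘(ℝ, Mat n →L[ℝ] ℝ)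

/-- The Liouville form `θ_{(g,p)}(v, π) = p(v)`. -/
def liouville (x : Mat n × (Mat n →L[ℝ] ℝ)) : Mat n × (Mat n →L[ℝ] ℝ) →L[ℝ] ℝ :=
  x.2.comp (ContinuousLinearMap.fst ℝ (Mat n) (Mat n →L[ℝ] ℝ))

/-- The canonical symplectic form `ω = -dθ`, that is,
`ω(a, b) = (D_b θ)(a) - (D_a θ)(b)` for constant vector fields `a`, `b`. -/
def canonicalForm (x a b : Mat n × (Mat n →L[ℝ] ℝ)) : ℝ :=
  fderiv ℝ liouville x b a - fderiv ℝ liouville x a b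

/-- The Hamiltonian vector field `ξ_f` at `x`: `ω(ξ_f, ·) = df`. -/
def hamiltonianField (f : CotangentGL n → ℝ) (x : CotangentGL n) : Mat n × (Mat n →L[ℝ] ℝ) :=
  gradientWrt (canonicalForm ((x.1 : Mat n), x.2)) fun a => mfderiv (ICot n) 𝓘(ℝ, ℝ) f x a

/-- The canonical Poisson bracket `{f, h} = ω(ξ_f, ξ_h) = ξ_h(f)`; with this sign
`{q, p} = 1` for canonical coordinates. -/
def canonicalBracket (f h : CotangentGL n → ℝ) (x : CotangentGL n) : ℝ :=
  canonicalForm ((x.1 : Mat n), x.2) (hamiltonianField f x) (hamiltonianField h x)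

/-! ### The Heisenberg double of `GL(n,ℂ)` -/

/-- `⟨(X₁,X₂), (Y₁,Y₂)⟩₂ = ⟨X₁,Y₁⟩ - ⟨X₂,Y₂⟩` on `gl(n,ℂ) ⊕ gl(n,ℂ)`. -/
def pairing2 (X Y : Mat n × Mat n) : ℝ := pairing X.1 Y.1 - pairing X.2 Y.2

/-- The projection onto `{(r₊ X, r₋ X)}` along the diagonal `{(X, X)}`. -/
def projDual (X : Mat n × Mat n) : Mat n × Mat n := (rPlus (X.1 - X.2), rMinus (X.1 - X.2))

/-- The projection onto the diagonal `{(X, X)}` along `{(r₊ X, r₋ X)}`. -/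
def projDiag (X : Mat n × Mat n) : Mat n × Mat n := X - projDual X

theorem rPlus_sub_rMinus (X : Mat n) : rPlus X - rMinus X = X := by
  unfold rPlus rMinus
  rw [add_sub_sub_cancel, ← add_smul]; norm_num

theorem projDiag_mem (X : Mat n × Mat n) : ∃ Y, projDiag X = (Y, Y) := by
  refine ⟨(projDiag X).1, Prod.ext rfl ?_⟩
  have h := rPlus_sub_rMinus (X.1 - X.2)
  simp only [projDiag, projDual, Prod.fst_sub, Prod.snd_sub]
  rw [sub_eq_sub_iff_sub_eq_sub, ← neg_inj, neg_sub, neg_sub, eq_comm]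
  exact h

/-- The two subspaces are complementary: the decomposition of `X` is unique. -/
theorem projDual_unique {X : Mat n × Mat n} {Y Z : Mat n}
    (h : X = (Y, Y) + (rPlus Z, rMinus Z)) : projDual X = (rPlus Z, rMinus Z) := by
  subst h
  have h := rPlus_sub_rMinus Z
  simp [projDual, h]

/-- `ρ = (P_δ - P_*) / 2`. -/
def rho (X : Mat n × Mat n) : Mat n × Mat n := (1 / 2 : ℝ) • (projDiag X - projDual X)

/-- `⟨𝒟F(g₁,g₂), (X₁,X₂)⟩₂ = d/dt F(e^{tX₁} g₁, e^{tX₂} g₂)` at `t = 0`. -/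
def leftDeriv (F : GL (Fin n) ℂ × GL (Fin n) ℂ → ℝ) (y : GL (Fin n) ℂ × GL (Fin n) ℂ) :
    Mat n × Mat n :=
  gradientWrt pairing2 fun X =>
    deriv (fun t : ℝ => F (expGL (t • X.1) * y.1, expGL (t • X.2) * y.2)) 0

/-- `⟨𝒟'F(g₁,g₂), (X₁,X₂)⟩₂ = d/dt F(g₁ e^{tX₁}, g₂ e^{tX₂})` at `t = 0`. -/
def rightDeriv (F : GL (Fin n) ℂ × GL (Fin n) ℂ → ℝ) (y : GL (Fin n) ℂ × GL (Fin n) ℂ) :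
    Mat n × Mat n :=
  gradientWrt pairing2 fun X =>
    deriv (fun t : ℝ => F (y.1 * expGL (t • X.1), y.2 * expGL (t • X.2))) 0

/-- Semenov-Tian-Shansky's bracket of the Heisenberg double:
`{F,H}₊ = ⟨𝒟F, ρ 𝒟H⟩₂ + ⟨𝒟'F, ρ 𝒟'H⟩₂`. -/
def heisenbergBracket (F H : GL (Fin n) ℂ × GL (Fin n) ℂ → ℝ)
    (y : GL (Fin n) ℂ × GL (Fin n) ℂ) : ℝ :=
  pairing2 (leftDeriv F y) (rho (leftDeriv H y)) + pairing2 (rightDeriv F y) (rho (rightDeriv H y))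

/-- `u` is upper triangular with unit diagonal, `d` is diagonal, and `l` is lower triangular with
unit diagonal. -/
structure IsTriangularTriple (u d l : GL (Fin n) ℂ) : Prop where
  upper : ∀ i j, j < i → (u : Mat n) i j = 0
  upper_diag : ∀ i, (u : Mat n) i i = 1
  diag : ∀ i j, i ≠ j → (d : Mat n) i j = 0
  lower : ∀ i j, i < j → (l : Mat n) i j = 0
  lower_diag : ∀ i, (l : Mat n) i i = 1

/-- The element `η_* = (η_> η₀, (η₀ η_<)⁻¹)` of the dual group. -/
def dualElt (u d l : GL (Fin n) ℂ) : GL (Fin n) ℂ × GL (Fin n) ℂ := (u * d, (d * l)⁻¹)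

/-- The relation between a point `y = (g₁,g₂)` of the double and the point `x = (g,J)`:
`y = g_{δL} η_{*R}⁻¹ = η_{*L} g_{δR}⁻¹` with `g_{δR} = (g,g)` and `J = η_> η₀² η_<`, where
`η_>, η₀, η_<` are the components of `η_{*R}`. -/
def FactorRel (y : GL (Fin n) ℂ × GL (Fin n) ℂ) (x : M n) : Prop :=
  ∃ gL u d l u' d' l' : GL (Fin n) ℂ, IsTriangularTriple u d l ∧ IsTriangularTriple u' d' l' ∧
    y = (gL, gL) * (dualElt u d l)⁻¹ ∧ y = dualElt u' d' l' * (x.1, x.1)⁻¹ ∧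
    x.2 = ((u * d * d * l : GL (Fin n) ℂ) : Mat n)

end BiHam

end

/-!
`GL(n,ℂ)` is open in `gl(n,ℂ)`, so `M` is open in the vector space `gl(n,ℂ) × gl(n,ℂ)`. In these
coordinates the derivatives `∇₁F`, `∇₁'F`, `d₂F` are products of the gradient of `F` with the base
point (`nabla1_eq`, `nabla1'_eq`, `d2_eq`), and both brackets come from bivector fields defined on
the whole vector space: a linear one, `tensor1`, and a quadratic one, `tensor2`. For such a bracket
the second derivatives cancel in the Jacobi sum, and what is left is the Schouten bracket of the
bivector with itself (`IsPoissonTensor.jacobi`). That the second bracket of linear functions is a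
quadratic form is then read off from `tensor2`.

For the first bracket the Schouten bracket vanishes by cyclicity of the trace. The second bracket
is the image of a constant tensor `quadR` on `gl(n,ℂ)⁴` under the infinitesimal action of
`GL(n,ℂ)⁴` by left and right multiplications. As `r` satisfies the modified classical Yang-Baxter
equation (`triple_r`), so does `quadR` (`quadR_yangBaxter`). The right-hand side of that equation
is an invariant trilinear form, which vanishes on the derivatives of functions because
`tr (gA gB gC) = tr (Ag Bg Cg)` (`triple_mul_comm`).

The symplectic form of `T^*GL(n,ℂ)` is constant in matrix coordinates, so the canonical bracket is
explicit (`canonicalBracket_eq`), and right trivialization turns it into the first bracket by the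
chain rule.

For the Heisenberg double, the factorization of matrices near the identity into an upper and a lower
triangular factor with equal diagonals is the local inverse of `X ↦ (1 + r₊ X) (1 - r₋ X)`
(`exists_factorization`). Writing `g₁ g₂⁻¹ = b c` in this way, the diffeomorphism is
`ψ (g₁, g₂) = (g₁⁻¹ b, g₁⁻¹ g₂)`. Its inverse is explicit too: if `J = g₁⁻¹ g₂` and `g = g₁⁻¹ b`
then `g⁻¹ J g = b⁻¹ c⁻¹`, so `b` is recovered by factorizing `g⁻¹ J g`. Differentiating `b`
(`hasDerivAt_upperFactor`) gives the left and right derivatives of `F ∘ ψ`, decomposed along the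
diagonal and the dual subspace (`leftDeriv_comp_doubleMap`, `rightDeriv_comp_doubleMap`). Both
subspaces are isotropic, so that `⟨·, ρ ·⟩₂` only involves the mixed terms (`pairing2_rho`), and the
comparison of the brackets becomes the algebraic identity `bracket_identity`.
-/

noncomputable section

namespace BiHam

variable {n : ℕ}

-- the value with which Mathlib itself is compiled
set_option maxSynthPendingDepth 3

/-! ### Algebra of the trace form and of the r-matrix -/

section Pairing

variable (X X' Y Y' Z : Mat n) (c : ℝ)

theorem pairing_add_left : pairing (X + X') Y = pairing X Y + pairing X' Y := by
  simp [pairing, add_mul]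

theorem pairing_add_right : pairing X (Y + Y') = pairing X Y + pairing X Y' := by
  simp [pairing, mul_add]

theorem pairing_sub_left : pairing (X - X') Y = pairing X Y - pairing X' Y := by
  simp [pairing, sub_mul]

theorem pairing_sub_right : pairing X (Y - Y') = pairing X Y - pairing X Y' := by
  simp [pairing, mul_sub]

theorem pairing_neg_left : pairing (-X) Y = -pairing X Y := by
  simp [pairing]

theorem pairing_neg_right : pairing X (-Y) = -pairing X Y := by
  simp [pairing]

theorem pairing_smul_left : pairing (c • X) Y = c * pairing X Y := by
  simp [pairing]

theorem pairing_smul_right : pairing X (c • Y) = c * pairing X Y := by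
  simp [pairing]

theorem pairing_comm : pairing X Y = pairing Y X := by
  rw [pairing, pairing, Matrix.trace_mul_comm]

theorem pairing_mul_left : pairing (X * Y) Z = pairing X (Y * Z) := by
  rw [pairing, pairing, mul_assoc]

/-- Cyclicity of the trace. -/
theorem pairing_mul_cyclic : pairing (X * Y) Z = pairing Y (Z * X) := by
  rw [pairing_comm, ← pairing_mul_left, pairing_comm]

end Pairing

section RMatrix

variable (X Y Z : Mat n) (c : ℝ)

theorem r_apply (i j : Fin n) : r X i j =
    (if i < j then (1 / 2 : ℂ) else if j < i then -(1 / 2 : ℂ) else 0) * X i j := by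
  simp only [r, Matrix.of_apply]
  split_ifs <;> simp

theorem r_add : r (X + Y) = r X + r Y := by
  ext i j; simp only [r_apply, Matrix.add_apply]; ring

theorem r_sub : r (X - Y) = r X - r Y := by
  ext i j; simp only [r_apply, Matrix.sub_apply]; ring

theorem r_smul : r (c • X) = c • r X := by
  ext i j; simp only [r_apply, Matrix.smul_apply, Complex.real_smul]; ring

/-- The map `r` as a linear map. -/
def rLin : Mat n →ₗ[ℝ] Mat n where
  toFun := r
  map_add' := r_add
  map_smul' c X := r_smul X c

/-- `r` is antisymmetric with respect to the trace form. -/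
theorem pairing_r_left : pairing (r X) Y = -pairing X (r Y) := by
  have h : (r X * Y).trace = -(X * r Y).trace := by
    simp only [Matrix.trace, Matrix.diag, Matrix.mul_apply, r_apply, ← Finset.sum_neg_distrib]
    refine Finset.sum_congr rfl fun i _ => Finset.sum_congr rfl fun j _ => ?_
    rcases lt_trichotomy i j with h | h | h
    · simp only [h, h.not_gt, if_true, if_false]; ring
    · simp [h]
    · simp only [h, h.not_gt, if_true, if_false]; ring
  simp only [pairing, h, Complex.neg_re]

theorem pairing_r_swap : pairing X (r Y) = -pairing Y (r X) := by
  rw [← pairing_r_left, pairing_comm]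

theorem trace_mul_mul : (X * Y * Z).trace = ∑ i, ∑ j, ∑ k, X i j * Y j k * Z k i := by
  simp only [Matrix.trace, Matrix.diag, Matrix.mul_apply, Finset.sum_mul]
  exact Finset.sum_congr rfl fun i _ => Finset.sum_comm

/-- The associative form of the modified classical Yang-Baxter equation, paired with a third
matrix. The last term is symmetric in `X`, `Y`. -/
theorem trace_r_mul_r : (r X * r Y * Z).trace + (X * r Y * r Z).trace + (r X * Y * r Z).trace
    = -(1 / 4) * (X * Y * Z).trace + (1 / 4) * ∑ i, X i i * Y i i * Z i i := by
  have h : ∀ i : Fin n, X i i * Y i i * Z i i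
      = ∑ j, ∑ k, if i = j ∧ j = k then X i j * Y j k * Z k i else 0 := by
    intro i
    simp only [ite_and]
    simp
  simp only [trace_mul_mul, h, Finset.mul_sum, ← Finset.sum_add_distrib]
  refine Finset.sum_congr rfl fun i _ => Finset.sum_congr rfl fun j _ =>
    Finset.sum_congr rfl fun k _ => ?_
  simp only [r_apply]
  -- the entrywise identity only depends on the relative order of `i`, `j`, `k`
  rcases lt_trichotomy i j with h1 | h1 | h1 <;> rcases lt_trichotomy j k with h2 | h2 | h2 <;>
    rcases lt_trichotomy i k with h3 | h3 | h3 <;>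
    first
    | (exfalso; omega)
    | (simp only [h1, h2, h3, h1.ne, h1.ne', h2.ne, h2.ne', h1.not_gt, h2.not_gt,
        h3.not_gt, if_true, if_false, and_false]; ring)
    | (subst_vars; simp [*, not_lt_of_gt, ne_of_lt, ne_of_gt]; try ring)

/-- The invariant trilinear form `⟨[X, Y], Z⟩`. -/
def triple (X Y Z : Mat n) : ℝ := pairing (X * Y - Y * X) Z

/-- The modified classical Yang-Baxter equation for `r`, in weak form. -/
theorem triple_r : triple (r X) (r Y) Z + triple X (r Y) (r Z) + triple (r X) Y (r Z)
    = -(1 / 4) * triple X Y Z := by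
  have h1 := congrArg Complex.re (trace_r_mul_r X Y Z)
  have h2 := congrArg Complex.re (trace_r_mul_r Y X Z)
  have h3 : ∑ i, Y i i * X i i * Z i i = ∑ i, X i i * Y i i * Z i i :=
    Finset.sum_congr rfl fun i _ => by ring
  rw [h3] at h2
  have h4 : ((1 / 4 : ℂ)) = ((1 / 4 : ℝ) : ℂ) := by norm_num
  simp only [h4, ← Complex.ofReal_neg, Complex.add_re, Complex.re_ofReal_mul] at h1 h2
  simp only [triple, pairing, sub_mul, Matrix.trace_sub, Complex.sub_re]
  linarith

end RMatrix

section Triple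

variable (X X' Y Y' Z Z' : Mat n) (c : ℝ)

theorem triple_add_left : triple (X + X') Y Z = triple X Y Z + triple X' Y Z := by
  simp only [triple, add_mul, mul_add, pairing_add_left, pairing_sub_left]; ring

theorem triple_sub_left : triple (X - X') Y Z = triple X Y Z - triple X' Y Z := by
  simp only [triple, sub_mul, mul_sub, pairing_sub_left]; ring

theorem triple_neg_left : triple (-X) Y Z = -triple X Y Z := by
  simp only [triple, neg_mul, mul_neg, pairing_neg_left, pairing_sub_left]; ring

theorem triple_smul_left : triple (c • X) Y Z = c * triple X Y Z := by
  simp only [triple, smul_mul_assoc, mul_smul_comm, pairing_smul_left, pairing_sub_left]; ring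

theorem triple_cyclic : triple X Y Z = triple Y Z X := by
  have h1 := pairing_mul_cyclic X Y Z
  have h2 := pairing_mul_cyclic Y X Z
  have h3 := pairing_mul_cyclic X Z Y
  simp only [triple, pairing_sub_left, pairing_mul_left] at *
  linarith

theorem triple_add_mid : triple X (Y + Y') Z = triple X Y Z + triple X Y' Z := by
  simp only [triple_cyclic X, triple_add_left]

theorem triple_sub_mid : triple X (Y - Y') Z = triple X Y Z - triple X Y' Z := by
  simp only [triple_cyclic X, triple_sub_left]

theorem triple_neg_mid : triple X (-Y) Z = -triple X Y Z := by
  simp only [triple_cyclic X, triple_neg_left]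

theorem triple_smul_mid : triple X (c • Y) Z = c * triple X Y Z := by
  simp only [triple_cyclic X, triple_smul_left]

theorem triple_add_right : triple X Y (Z + Z') = triple X Y Z + triple X Y Z' := by
  simp only [triple, pairing_add_right]

theorem triple_sub_right : triple X Y (Z - Z') = triple X Y Z - triple X Y Z' := by
  simp only [triple, pairing_sub_right]

theorem triple_neg_right : triple X Y (-Z) = -triple X Y Z := by
  simp only [triple, pairing_neg_right]

theorem triple_smul_right : triple X Y (c • Z) = c * triple X Y Z := by
  simp only [triple, pairing_smul_right]

/-- The trilinear form takes the same value on left and on right multiples of three matrices. This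
is why the right-hand side of the modified Yang-Baxter equation does not obstruct the Jacobi
identity. -/
theorem triple_mul_comm (g : Mat n) :
    triple (g * X) (g * Y) (g * Z) = triple (X * g) (Y * g) (Z * g) := by
  have h : ∀ A B C : Mat n,
      pairing (g * A * (g * B)) (g * C) = pairing (A * g * (B * g)) (C * g) := by
    intro A B C
    rw [mul_assoc, pairing_mul_cyclic]; simp only [pairing_mul_left, mul_assoc]
  simp only [triple, pairing_sub_left, h]

end Triple

/-! ### Poisson tensors on a vector space -/

section Tensor

variable {E : Type*} [NormedAddCommGroup E] [NormedSpace ℝ E]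

/-- A smooth Poisson tensor `P` on a vector space, as a family of bilinear forms on covectors.
The map `ham x` turns a covector `α` into the vector `P x · α`, and the last condition is the
vanishing of the Schouten bracket of `P` with itself. -/
structure IsPoissonTensor (P : E → (E →L[ℝ] ℝ) →L[ℝ] (E →L[ℝ] ℝ) →L[ℝ] ℝ)
    (ham : E → (E →L[ℝ] ℝ) → E) : Prop where
  smooth : ContDiff ℝ ∞ P
  antisymm : ∀ x α β, P x α β = -P x β α
  ham_spec : ∀ x α β, β (ham x α) = P x β α
  schouten : ∀ x α β γ, fderiv ℝ P x (ham x α) β γ + fderiv ℝ P x (ham x β) γ α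
    + fderiv ℝ P x (ham x γ) α β = 0

variable {P : E → (E →L[ℝ] ℝ) →L[ℝ] (E →L[ℝ] ℝ) →L[ℝ] ℝ} {ham : E → (E →L[ℝ] ℝ) → E}

theorem contDiffAt_fderiv {f : E → ℝ} {x : E} (hf : ContDiffAt ℝ ∞ f x) :
    ContDiffAt ℝ ∞ (fderiv ℝ f) x :=
  hf.fderiv_right (m := ∞) (by norm_num)

/-- The derivative of a bracket `{h, k}` in a direction `v`. -/
theorem fderiv_tensor_bracket (hP : IsPoissonTensor P ham) {h k : E → ℝ} {x : E}
    (hh : ContDiffAt ℝ ∞ h x) (hk : ContDiffAt ℝ ∞ k x) (v : E) :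
    fderiv ℝ (fun y => P y (fderiv ℝ h y) (fderiv ℝ k y)) x v
      = fderiv ℝ P x v (fderiv ℝ h x) (fderiv ℝ k x)
        + fderiv ℝ (fderiv ℝ h) x v (ham x (fderiv ℝ k x))
        - fderiv ℝ (fderiv ℝ k) x v (ham x (fderiv ℝ h x)) := by
  have h1 : DifferentiableAt ℝ P x := hP.smooth.contDiffAt.differentiableAt (by simp)
  have h2 := (contDiffAt_fderiv hh).differentiableAt (by simp)
  have h3 := (contDiffAt_fderiv hk).differentiableAt (by simp)
  have h4 := (h1.hasFDerivAt.clm_apply h2.hasFDerivAt).clm_apply h3.hasFDerivAt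
  rw [h4.fderiv, hP.ham_spec, hP.ham_spec, hP.antisymm x (fderiv ℝ (fderiv ℝ k) x v)]
  simp only [add_apply, ContinuousLinearMap.comp_apply,
    ContinuousLinearMap.flip_apply]
  ring

/-- The bracket of functions given by a Poisson tensor satisfies the Jacobi identity: the second
derivatives cancel by symmetry, and what is left is the Schouten bracket. -/
theorem IsPoissonTensor.jacobi (hP : IsPoissonTensor P ham) {f h k : E → ℝ} {x : E}
    (hf : ContDiffAt ℝ ∞ f x) (hh : ContDiffAt ℝ ∞ h x) (hk : ContDiffAt ℝ ∞ k x) :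
    P x (fderiv ℝ f x) (fderiv ℝ (fun y => P y (fderiv ℝ h y) (fderiv ℝ k y)) x)
    + P x (fderiv ℝ h x) (fderiv ℝ (fun y => P y (fderiv ℝ k y) (fderiv ℝ f y)) x)
    + P x (fderiv ℝ k x) (fderiv ℝ (fun y => P y (fderiv ℝ f y) (fderiv ℝ h y)) x) = 0 := by
  have symm : ∀ {g : E → ℝ}, ContDiffAt ℝ ∞ g x → ∀ v w,
      fderiv ℝ (fderiv ℝ g) x v w = fderiv ℝ (fderiv ℝ g) x w v := fun hg v w =>
    (hg.isSymmSndFDerivAt (by simp; exact WithTop.coe_le_coe.2 le_top)).eq v w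
  have key : ∀ {g u w : E → ℝ}, ContDiffAt ℝ ∞ u x → ContDiffAt ℝ ∞ w x →
      P x (fderiv ℝ g x) (fderiv ℝ (fun y => P y (fderiv ℝ u y) (fderiv ℝ w y)) x)
        = -(fderiv ℝ P x (ham x (fderiv ℝ g x)) (fderiv ℝ u x) (fderiv ℝ w x)
        + fderiv ℝ (fderiv ℝ u) x (ham x (fderiv ℝ g x)) (ham x (fderiv ℝ w x))
        - fderiv ℝ (fderiv ℝ w) x (ham x (fderiv ℝ g x)) (ham x (fderiv ℝ u x))) :=
    fun hu hw => by
      rw [← fderiv_tensor_bracket hP hu hw, hP.ham_spec, hP.antisymm]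
  rw [key hh hk, key hk hf, key hf hh]
  rw [symm hf (ham x (fderiv ℝ h x)), symm hh (ham x (fderiv ℝ k x)),
    symm hk (ham x (fderiv ℝ f x))]
  linarith [hP.schouten x (fderiv ℝ f x) (fderiv ℝ h x) (fderiv ℝ k x)]

end Tensor

/-! ### Gradients with respect to nondegenerate forms -/

/-- The trace form as a bilinear map. -/
def pairingLin : Mat n →ₗ[ℝ] Mat n →ₗ[ℝ] ℝ :=
  LinearMap.mk₂ ℝ pairing pairing_add_left (fun c X Y => pairing_smul_left X Y c)
    pairing_add_right (fun c X Y => pairing_smul_right X Y c)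

theorem pairingLin_apply (X Y : Mat n) : pairingLin X Y = pairing X Y := rfl

theorem pairing_nondegenerate {Y : Mat n} (h : ∀ X, pairing Y X = 0) : Y = 0 :=
  pairing_left_injective fun X => by rw [h, pairing, zero_mul]; simp

/-- The vector representing a functional with respect to the trace form. -/
def dualVec : (Mat n →L[ℝ] ℝ) →ₗ[ℝ] Mat n :=
  (LinearEquiv.symm (LinearMap.linearEquivOfInjective (pairingLin (n := n))
    ((injective_iff_map_eq_zero _).2 fun v hv => pairing_nondegenerate fun w => by
      rw [← pairingLin_apply, hv]; rfl)
    (Subspace.dual_finrank_eq (K := ℝ)).symm)).toLinearMap.comp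
  (ContinuousLinearMap.coeLM ℝ)

theorem pairing_dualVec (φ : Mat n →L[ℝ] ℝ) (X : Mat n) : pairing (dualVec φ) X = φ X := by
  rw [← pairingLin_apply, dualVec, LinearMap.comp_apply]
  set e := LinearMap.linearEquivOfInjective (pairingLin (n := n)) _ _
  change e (e.symm (φ : Mat n →ₗ[ℝ] ℝ)) X = _
  rw [LinearEquiv.apply_symm_apply]
  rfl

/-- The ambient vector space `gl(n,ℂ) × gl(n,ℂ)` of `M`. -/
abbrev E (n : ℕ) : Type := Mat n × Mat n

/-- Covectors on `gl(n,ℂ) × gl(n,ℂ)`. -/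
abbrev Cot (n : ℕ) : Type := E n →L[ℝ] ℝ

/-- The component of the gradient of a covector in the group direction. -/
def gradG : Cot n →ₗ[ℝ] Mat n where
  toFun α := dualVec (α.comp (ContinuousLinearMap.inl ℝ (Mat n) (Mat n)))
  map_add' α β := by rw [ContinuousLinearMap.add_comp, map_add]
  map_smul' c α := by rw [ContinuousLinearMap.smul_comp, map_smul]; rfl

/-- The component of the gradient of a covector in the direction of the Lie algebra. -/
def gradJ : Cot n →ₗ[ℝ] Mat n where
  toFun α := dualVec (α.comp (ContinuousLinearMap.inr ℝ (Mat n) (Mat n)))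
  map_add' α β := by rw [ContinuousLinearMap.add_comp, map_add]
  map_smul' c α := by rw [ContinuousLinearMap.smul_comp, map_smul]; rfl

theorem cot_apply (α : Cot n) (v : E n) :
    α v = pairing (gradG α) v.1 + pairing (gradJ α) v.2 := by
  simp only [gradG, gradJ, LinearMap.coe_mk, AddHom.coe_mk, pairing_dualVec]
  simp [← map_add]

theorem gradientWrt_pairing_eq {φ : Mat n → ℝ} {Y : Mat n} (h : ∀ X, pairing Y X = φ X) :
    gradientWrt pairing φ = Y :=
  pairing_left_injective fun X => by rw [gradientWrt_spec ⟨Y, h⟩, h]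

/-! ### Coordinates on `GL(n,ℂ)` -/

/-- The unit with a given underlying matrix (and `1` if there is none). -/
def toGL (a : Mat n) : GL (Fin n) ℂ :=
  open Classical in if h : IsUnit a then h.unit else 1

theorem coe_toGL {a : Mat n} (h : IsUnit a) : ((toGL a : GL (Fin n) ℂ) : Mat n) = a := by
  simp [toGL, h]

theorem toGL_coe (g : GL (Fin n) ℂ) : toGL (g : Mat n) = g :=
  Units.ext (coe_toGL g.isUnit)

theorem contMDiffAt_toGL (g : GL (Fin n) ℂ) :
    ContMDiffAt 𝓘(ℝ, Mat n) 𝓘(ℝ, Mat n) ∞ (toGL (n := n)) (g : Mat n) := by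
  have h := contMDiffOn_chart_symm (I := 𝓘(ℝ, Mat n)) (n := ∞) (x := g)
  have ht : (chartAt (Mat n) g).target ∈ nhds (g : Mat n) :=
    (chartAt (Mat n) g).open_target.mem_nhds (mem_chart_target (Mat n) g)
  refine (h.contMDiffAt ht).congr_of_eventuallyEq ?_
  filter_upwards [ht] with a ha
  have h1 := (chartAt (Mat n) g).right_inv ha
  rw [Units.chartAt_apply] at h1
  refine Units.ext ?_
  rw [h1]
  exact coe_toGL (h1 ▸ Units.isUnit _)

/-- The inclusion of `M` into the ambient vector space. -/
def emb (x : M n) : E n := ((x.1 : Mat n), x.2)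

/-- A function on `M` as a function of matrices. -/
def coordFn (F : M n → ℝ) (z : E n) : ℝ := F (toGL z.1, z.2)

theorem coordFn_emb (F : M n → ℝ) (x : M n) : coordFn F (emb x) = F x := by
  simp [coordFn, emb, toGL_coe]

theorem contMDiff_emb : ContMDiff (IM n) 𝓘(ℝ, E n) ∞ (emb (n := n)) :=
  (Units.contMDiff_val.comp contMDiff_fst).prodMk_space contMDiff_snd

theorem contMDiffAt_retract (x : M n) :
    ContMDiffAt 𝓘(ℝ, E n) (IM n) ∞ (fun z : E n => ((toGL z.1, z.2) : M n)) (emb x) :=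
  ((contMDiffAt_toGL x.1).comp (emb x) contDiff_fst.contMDiff.contMDiffAt).prodMk
    contDiff_snd.contMDiff.contMDiffAt

theorem contDiffAt_coordFn {F : M n → ℝ} {x : M n} (hF : ContMDiffAt (IM n) 𝓘(ℝ, ℝ) ∞ F x) :
    ContDiffAt ℝ ∞ (coordFn F) (emb x) := by
  rw [← contMDiffAt_iff_contDiffAt]
  refine ContMDiffAt.comp (emb x) (I' := IM n) (g := F) ?_ (contMDiffAt_retract x)
  simpa [emb, toGL_coe] using hF

theorem contMDiffAt_comp_emb {f : E n → ℝ} {x : M n} (hf : ContDiffAt ℝ ∞ f (emb x)) :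
    ContMDiffAt (IM n) 𝓘(ℝ, ℝ) ∞ (fun y => f (emb y)) x :=
  (contMDiffAt_iff_contDiffAt.2 hf).comp x contMDiff_emb.contMDiffAt

theorem eventually_isUnit (g : GL (Fin n) ℂ) : ∀ᶠ a in nhds (g : Mat n), IsUnit a :=
  Units.isOpen.mem_nhds g.isUnit

theorem eventually_mem_range_emb (x : M n) : ∀ᶠ z in nhds (emb x), ∃ y : M n, emb y = z := by
  have h : ∀ᶠ z in nhds (emb x), IsUnit z.1 :=
    (continuous_fst.tendsto (emb x)).eventually (eventually_isUnit x.1)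
  filter_upwards [h] with z hz
  exact ⟨(toGL z.1, z.2), Prod.ext (coe_toGL hz) rfl⟩

/-! ### The derivatives in coordinates -/

theorem coe_expGL (X : Mat n) : ((expGL X : GL (Fin n) ℂ) : Mat n) = NormedSpace.exp X := rfl

theorem expGL_zero : (expGL (0 : Mat n)) = 1 := Units.ext (by simp [coe_expGL])

theorem hasDerivAt_expGL (X : Mat n) :
    HasDerivAt (fun t : ℝ => ((expGL (t • X) : GL (Fin n) ℂ) : Mat n)) X 0 := by
  have h := hasDerivAt_exp_smul_const (𝕂 := ℝ) X (0 : ℝ)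
  simp only [zero_smul, NormedSpace.exp_zero, one_mul] at h
  exact h

/-- The chain rule for a curve in `M`. -/
theorem hasDerivAt_comp_curve {F : M n → ℝ} {x : M n} {γ : ℝ → M n} {v : E n}
    (hF : DifferentiableAt ℝ (coordFn F) (emb x)) (h0 : γ 0 = x)
    (hγ : HasDerivAt (fun t => emb (γ t)) v 0) :
    HasDerivAt (fun t => F (γ t)) (fderiv ℝ (coordFn F) (emb x) v) 0 := by
  have h : HasFDerivAt (coordFn F) (fderiv ℝ (coordFn F) (emb x)) (emb (γ 0)) := by
    rw [h0]; exact hF.hasFDerivAt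
  have h2 := h.comp_hasDerivAt (0 : ℝ) hγ
  simpa only [Function.comp_def, coordFn_emb] using h2

section Nabla

variable {F : M n → ℝ} {x : M n} (hF : DifferentiableAt ℝ (coordFn F) (emb x))

include hF

theorem hasDerivAt_left (X : Mat n) : HasDerivAt (fun t : ℝ => F (expGL (t • X) * x.1, x.2))
    (pairing ((x.1 : Mat n) * gradG (fderiv ℝ (coordFn F) (emb x))) X) 0 := by
  have h : HasDerivAt (fun t : ℝ => emb (expGL (t • X) * x.1, x.2)) (X * (x.1 : Mat n), 0) 0 :=
    ((hasDerivAt_expGL X).mul_const _).prodMk (hasDerivAt_const _ _)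
  convert hasDerivAt_comp_curve hF (by simp [expGL_zero]) h using 1
  rw [cot_apply, pairing_mul_cyclic]
  simp [pairing]

theorem hasDerivAt_right (X : Mat n) : HasDerivAt (fun t : ℝ => F (x.1 * expGL (t • X), x.2))
    (pairing (gradG (fderiv ℝ (coordFn F) (emb x)) * (x.1 : Mat n)) X) 0 := by
  have h : HasDerivAt (fun t : ℝ => emb (x.1 * expGL (t • X), x.2)) ((x.1 : Mat n) * X, 0) 0 :=
    ((hasDerivAt_expGL X).const_mul _).prodMk (hasDerivAt_const _ _)
  convert hasDerivAt_comp_curve hF (by simp [expGL_zero]) h using 1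
  rw [cot_apply, pairing_mul_left]
  simp [pairing]

theorem hasDerivAt_add (X : Mat n) : HasDerivAt (fun t : ℝ => F (x.1, x.2 + t • X))
    (pairing (gradJ (fderiv ℝ (coordFn F) (emb x))) X) 0 := by
  have h : HasDerivAt (fun t : ℝ => emb (x.1, x.2 + t • X)) (0, X) 0 := by
    have h1 : HasDerivAt (fun t : ℝ => t • X) ((1 : ℝ) • X) 0 :=
      (hasDerivAt_id (0 : ℝ)).smul_const X
    rw [one_smul] at h1
    exact (hasDerivAt_const (0 : ℝ) (x.1 : Mat n)).prodMk (h1.const_add x.2)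
  convert hasDerivAt_comp_curve hF (by rw [zero_smul, add_zero]) h using 1
  rw [cot_apply]
  simp [pairing]

theorem nabla1_eq : nabla1 F x = (x.1 : Mat n) * gradG (fderiv ℝ (coordFn F) (emb x)) :=
  gradientWrt_pairing_eq fun X => (hasDerivAt_left hF X).deriv.symm

theorem nabla1'_eq : nabla1' F x = gradG (fderiv ℝ (coordFn F) (emb x)) * (x.1 : Mat n) :=
  gradientWrt_pairing_eq fun X => (hasDerivAt_right hF X).deriv.symm

theorem d2_eq : d2 F x = gradJ (fderiv ℝ (coordFn F) (emb x)) :=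
  gradientWrt_pairing_eq fun X => (hasDerivAt_add hF X).deriv.symm

end Nabla

/-! ### From Poisson tensors to Poisson brackets on `M` -/

theorem contDiffAt_tensor_bracket {V : Type*} [NormedAddCommGroup V] [NormedSpace ℝ V]
    {P : V → (V →L[ℝ] ℝ) →L[ℝ] (V →L[ℝ] ℝ) →L[ℝ] ℝ} (hP : ContDiff ℝ ∞ P) {f h : V → ℝ} {x : V}
    (hf : ContDiffAt ℝ ∞ f x) (hh : ContDiffAt ℝ ∞ h x) :
    ContDiffAt ℝ ∞ (fun y => P y (fderiv ℝ f y) (fderiv ℝ h y)) x :=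
  (hP.contDiffAt.clm_apply (contDiffAt_fderiv hf)).clm_apply (contDiffAt_fderiv hh)

theorem SmoothFn.contDiffAt_coord (F : SmoothFn n) (x : M n) :
    ContDiffAt ℝ ∞ (coordFn F) (emb x) :=
  contDiffAt_coordFn F.contMDiff.contMDiffAt

theorem SmoothFn.differentiableAt_coord (F : SmoothFn n) (x : M n) :
    DifferentiableAt ℝ (coordFn F) (emb x) :=
  (SmoothFn.contDiffAt_coord F x).differentiableAt (by simp)

section Bracket

variable (P : E n → Cot n →L[ℝ] Cot n →L[ℝ] ℝ) (hP : ContDiff ℝ ∞ P)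

/-- The bracket of two smooth functions on `M` defined by a tensor on the ambient space. -/
def tensorBracketFn (F H : SmoothFn n) : SmoothFn n :=
  ⟨fun x => P (emb x) (fderiv ℝ (coordFn F) (emb x)) (fderiv ℝ (coordFn H) (emb x)), fun x =>
    contMDiffAt_comp_emb (f := fun z => P z (fderiv ℝ (coordFn F) z) (fderiv ℝ (coordFn H) z))
      (contDiffAt_tensor_bracket hP (SmoothFn.contDiffAt_coord F x)
        (SmoothFn.contDiffAt_coord H x))⟩

theorem tensorBracketFn_apply (F H : SmoothFn n) (x : M n) : tensorBracketFn P hP F H x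
    = P (emb x) (fderiv ℝ (coordFn F) (emb x)) (fderiv ℝ (coordFn H) (emb x)) := rfl

theorem fderiv_coordFn_add (F H : SmoothFn n) (x : M n) :
    fderiv ℝ (coordFn (⇑F + ⇑H)) (emb x)
      = fderiv ℝ (coordFn F) (emb x) + fderiv ℝ (coordFn H) (emb x) :=
  fderiv_add (SmoothFn.differentiableAt_coord F x) (SmoothFn.differentiableAt_coord H x)

theorem fderiv_coordFn_smul (c : ℝ) (F : SmoothFn n) (x : M n) :
    fderiv ℝ (coordFn (c • ⇑F)) (emb x) = c • fderiv ℝ (coordFn F) (emb x) :=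
  fderiv_const_smul (SmoothFn.differentiableAt_coord F x) c

theorem fderiv_coordFn_mul (F H : SmoothFn n) (x : M n) :
    fderiv ℝ (coordFn (⇑F * ⇑H)) (emb x)
      = F x • fderiv ℝ (coordFn H) (emb x) + H x • fderiv ℝ (coordFn F) (emb x) := by
  have h := fderiv_mul (SmoothFn.differentiableAt_coord F x) (SmoothFn.differentiableAt_coord H x)
  rw [coordFn_emb, coordFn_emb] at h
  exact h

/-- The bracket defined by a tensor, as a bilinear map on the smooth functions on `M`. -/
def tensorBracket : SmoothFn n →ₗ[ℝ] SmoothFn n →ₗ[ℝ] SmoothFn n :=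
  LinearMap.mk₂ ℝ (tensorBracketFn P hP)
    (fun F F' H => by
      ext x
      simp only [ContMDiffMap.coe_add, Pi.add_apply, tensorBracketFn_apply, fderiv_coordFn_add,
        map_add, add_apply])
    (fun c F H => by
      ext x
      simp only [ContMDiffMap.coe_smul, Pi.smul_apply, tensorBracketFn_apply, fderiv_coordFn_smul,
        map_smul, smul_apply])
    (fun F H H' => by
      ext x
      simp only [ContMDiffMap.coe_add, Pi.add_apply, tensorBracketFn_apply, fderiv_coordFn_add,
        map_add])
    (fun c F H => by
      ext x
      simp only [ContMDiffMap.coe_smul, Pi.smul_apply, tensorBracketFn_apply, fderiv_coordFn_smul,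
        map_smul])

theorem tensorBracket_apply (F H : SmoothFn n) (x : M n) : tensorBracket P hP F H x
    = P (emb x) (fderiv ℝ (coordFn F) (emb x)) (fderiv ℝ (coordFn H) (emb x)) := rfl

theorem coordFn_tensorBracket (F H : SmoothFn n) (x : M n) :
    coordFn (tensorBracket P hP F H)
      =ᶠ[nhds (emb x)] fun z => P z (fderiv ℝ (coordFn F) z) (fderiv ℝ (coordFn H) z) := by
  filter_upwards [eventually_mem_range_emb x] with z ⟨y, hy⟩
  rw [← hy, coordFn_emb, tensorBracket_apply]

variable {P hP}

/-- A Poisson tensor on the ambient space restricts to a Poisson bracket on the open subset `M`. -/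
theorem IsPoissonTensor.isPoissonBracket {ham : E n → Cot n → E n} (h : IsPoissonTensor P ham) :
    IsPoissonBracket (tensorBracket P h.smooth) where
  antisymm F H := by
    ext x
    rw [ContMDiffMap.coe_neg, Pi.neg_apply, tensorBracket_apply, tensorBracket_apply, h.antisymm]
  leibniz F H K := by
    ext x
    simp only [ContMDiffMap.coe_add, ContMDiffMap.coe_mul, Pi.add_apply, Pi.mul_apply,
      tensorBracket_apply, fderiv_coordFn_mul, map_add, map_smul, smul_eq_mul]
    ring
  jacobi F H K := by
    ext x
    have h1 := (coordFn_tensorBracket P h.smooth H K x).fderiv_eq (𝕜 := ℝ)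
    have h2 := (coordFn_tensorBracket P h.smooth K F x).fderiv_eq (𝕜 := ℝ)
    have h3 := (coordFn_tensorBracket P h.smooth F H x).fderiv_eq (𝕜 := ℝ)
    rw [ContMDiffMap.coe_add, ContMDiffMap.coe_add, Pi.add_apply, Pi.add_apply,
      tensorBracket_apply, tensorBracket_apply, tensorBracket_apply, h1, h2, h3]
    exact h.jacobi (SmoothFn.contDiffAt_coord F x) (SmoothFn.contDiffAt_coord H x)
      (SmoothFn.contDiffAt_coord K x)

end Bracket

section Tensor

variable {V : Type*} [NormedAddCommGroup V] [NormedSpace ℝ V] [FiniteDimensional ℝ V]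

/-- A field of bilinear forms on a finite-dimensional space is smooth when its values are. -/
theorem contDiff_toContinuousBilinearMap {W : Type*} [NormedAddCommGroup W] [NormedSpace ℝ W]
    {q : W → V →ₗ[ℝ] V →ₗ[ℝ] ℝ} (hq : ∀ α β, ContDiff ℝ ∞ fun x => q x α β) :
    ContDiff ℝ ∞ fun x => (q x).toContinuousBilinearMap := by
  rw [contDiff_clm_apply_iff]
  intro α
  rw [contDiff_clm_apply_iff]
  exact hq α

theorem fderiv_toContinuousBilinearMap {W : Type*} [NormedAddCommGroup W] [NormedSpace ℝ W]
    {q : W → V →ₗ[ℝ] V →ₗ[ℝ] ℝ} (hq : ∀ α β, ContDiff ℝ ∞ fun x => q x α β) (x v : W) (α β : V) :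
    fderiv ℝ (fun x => (q x).toContinuousBilinearMap) x v α β
      = fderiv ℝ (fun x => q x α β) x v := by
  have h := ((contDiff_toContinuousBilinearMap hq).contDiffAt (x := x)).differentiableAt (by simp)
  have h1 := (h.hasFDerivAt.clm_apply (hasFDerivAt_const α x)).clm_apply (hasFDerivAt_const β x)
  have h2 : fderiv ℝ (fun x => q x α β) x = _ := h1.fderiv
  rw [h2]
  simp

theorem contDiff_linear (l : V →ₗ[ℝ] ℝ) : ContDiff ℝ ∞ fun x => l x :=
  (LinearMap.toContinuousLinearMap l).contDiff

theorem fderiv_linear (l : V →ₗ[ℝ] ℝ) (x v : V) : fderiv ℝ (fun x => l x) x v = l v := by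
  have h := (LinearMap.toContinuousLinearMap l).hasFDerivAt (x := x)
  have h1 : fderiv ℝ (fun x => l x) x = _ := h.fderiv
  rw [h1]; rfl

theorem hasFDerivAt_diagonal (b : V →ₗ[ℝ] V →ₗ[ℝ] ℝ) (x : V) :
    HasFDerivAt (fun x => b x x)
      (b.toContinuousBilinearMap x + b.toContinuousBilinearMap.flip x) x := by
  have h := (b.toContinuousBilinearMap.hasFDerivAt (x := x)).clm_apply (hasFDerivAt_id x)
  convert! h using 1

theorem contDiff_diagonal (b : V →ₗ[ℝ] V →ₗ[ℝ] ℝ) : ContDiff ℝ ∞ fun x => b x x :=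
  (b.toContinuousBilinearMap.contDiff).clm_apply contDiff_id

theorem fderiv_diagonal (b : V →ₗ[ℝ] V →ₗ[ℝ] ℝ) (x v : V) :
    fderiv ℝ (fun x => b x x) x v = b v x + b x v := by
  rw [(hasFDerivAt_diagonal b x).fderiv, add_comm]
  rfl

end Tensor

/-! ### The first bracket -/

/-- The tensor of the first bracket; it is linear in the base point. -/
def form1 (α β : Cot n) : E n →ₗ[ℝ] ℝ where
  toFun x := pairing (x.1 * gradG α) (gradJ β) - pairing (x.1 * gradG β) (gradJ α)
    + pairing x.2 (gradJ α * gradJ β - gradJ β * gradJ α)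
  map_add' x y := by
    simp only [Prod.fst_add, Prod.snd_add, add_mul, pairing_add_left]; ring
  map_smul' c x := by
    simp only [Prod.smul_fst, Prod.smul_snd, smul_mul_assoc, pairing_smul_left, RingHom.id_apply,
      smul_eq_mul]; ring

/-- The tensor of the first bracket as a field of bilinear forms on covectors. -/
def bilin1 (x : E n) : Cot n →ₗ[ℝ] Cot n →ₗ[ℝ] ℝ :=
  LinearMap.mk₂ ℝ (fun α β => form1 α β x)
    (fun α α' β => by
      simp only [form1, LinearMap.coe_mk, AddHom.coe_mk, map_add, mul_add, add_mul,
        pairing_add_left, pairing_add_right, pairing_sub_right]; ring)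
    (fun c α β => by
      simp only [form1, LinearMap.coe_mk, AddHom.coe_mk, map_smul, smul_mul_assoc, mul_smul_comm,
        pairing_smul_left, pairing_smul_right, pairing_sub_right, smul_eq_mul]; ring)
    (fun α β β' => by
      simp only [form1, LinearMap.coe_mk, AddHom.coe_mk, map_add, mul_add, add_mul,
        pairing_add_left, pairing_add_right, pairing_sub_right]; ring)
    (fun c α β => by
      simp only [form1, LinearMap.coe_mk, AddHom.coe_mk, map_smul, smul_mul_assoc, mul_smul_comm,
        pairing_smul_left, pairing_smul_right, pairing_sub_right, smul_eq_mul]; ring)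

/-- The tensor of the first bracket. -/
def tensor1 (x : E n) : Cot n →L[ℝ] Cot n →L[ℝ] ℝ := (bilin1 x).toContinuousBilinearMap

/-- Hamiltonian vectors for the first bracket. -/
def ham1 (x : E n) (α : Cot n) : E n :=
  (gradJ α * x.1, gradJ α * x.2 - x.2 * gradJ α - x.1 * gradG α)

theorem tensor1_apply (x : E n) (α β : Cot n) : tensor1 x α β =
    pairing (x.1 * gradG α) (gradJ β) - pairing (x.1 * gradG β) (gradJ α)
    + pairing x.2 (gradJ α * gradJ β - gradJ β * gradJ α) := rfl

theorem fderiv_tensor1 (x v : E n) (α β : Cot n) : fderiv ℝ tensor1 x v α β = tensor1 v α β := by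
  have h := fderiv_toContinuousBilinearMap (q := bilin1 (n := n))
    (fun α β => contDiff_linear (form1 α β)) x v α β
  have h2 := fderiv_linear (form1 α β) x v
  exact h.trans h2

theorem isPoissonTensor1 : IsPoissonTensor (tensor1 (n := n)) ham1 where
  smooth := contDiff_toContinuousBilinearMap fun α β => contDiff_linear (form1 α β)
  antisymm x α β := by
    simp only [tensor1_apply, pairing_sub_right]; ring
  ham_spec x α β := by
    simp only [tensor1_apply, cot_apply, ham1, pairing_sub_right]
    have h1 := pairing_mul_cyclic x.1 (gradG β) (gradJ α)
    have h2 := pairing_comm (gradJ β) (x.1 * gradG α)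
    have h3 := pairing_mul_cyclic (gradJ β) (gradJ α) x.2
    have h4 := pairing_mul_left (gradJ β) x.2 (gradJ α)
    have h5 := pairing_mul_cyclic (gradJ β) x.2 (gradJ α)
    have h6 := pairing_mul_left (gradJ β) (gradJ α) x.2
    rw [pairing_comm x.2 (gradJ β * gradJ α)]
    linarith
  schouten x α β γ := by
    simp only [fderiv_tensor1]
    simp only [tensor1_apply, ham1, pairing, sub_mul, mul_sub,
      Matrix.trace_sub, Complex.sub_re, ← mul_assoc]
    generalize gradG α = A; generalize gradG β = B; generalize gradG γ = C
    generalize gradJ α = D; generalize gradJ β = D'; generalize gradJ γ = D''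
    generalize x.1 = g; generalize x.2 = J
    -- cyclic rotation brings the base point to the front of every word
    have c1 : ∀ Z X Y W : Mat n, (X * Z * Y * W).trace = (Z * Y * W * X).trace := fun Z X Y W => by
      rw [mul_assoc, mul_assoc, Matrix.trace_mul_comm]; simp only [mul_assoc]
    simp only [c1 g, c1 J]
    ring

theorem bracket1_eq {F H : M n → ℝ} {x : M n} (hF : DifferentiableAt ℝ (coordFn F) (emb x))
    (hH : DifferentiableAt ℝ (coordFn H) (emb x)) :
    bracket1 F H x = tensor1 (emb x) (fderiv ℝ (coordFn F) (emb x))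
      (fderiv ℝ (coordFn H) (emb x)) := by
  rw [bracket1, nabla1_eq hF, nabla1_eq hH, d2_eq hF, d2_eq hH, tensor1_apply]
  rfl

/-! ### The second bracket -/

/-- Quadruples of matrices, viewed as the Lie algebra of `GL(n,ℂ)⁴`, which acts on
`gl(n,ℂ) × gl(n,ℂ)` by left and right multiplications. -/
abbrev Quad (n : ℕ) : Type := E n × E n

/-- The four derivatives `(∇₁, ∇₁', ∇₂, ∇₂')` of a function with differential `α` at `x`. -/
def nablas : E n →ₗ[ℝ] Cot n →ₗ[ℝ] Quad n :=
  LinearMap.mk₂ ℝ (fun x α =>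
    ((x.1 * gradG α, gradG α * x.1), (x.2 * gradJ α, gradJ α * x.2)))
    (fun x x' α => by simp only [Prod.fst_add, Prod.snd_add, add_mul, mul_add, Prod.mk_add_mk])
    (fun c x α => by
      simp only [Prod.smul_fst, Prod.smul_snd, smul_mul_assoc, mul_smul_comm, Prod.smul_mk])
    (fun x α α' => by simp only [map_add, add_mul, mul_add, Prod.mk_add_mk])
    (fun c x α => by simp only [map_smul, smul_mul_assoc, mul_smul_comm, Prod.smul_mk])

theorem nablas_apply (x : E n) (α : Cot n) : nablas x α =
    ((x.1 * gradG α, gradG α * x.1), (x.2 * gradJ α, gradJ α * x.2)) := rfl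

/-- The invariant form on quadruples; the right factors enter with a minus sign. -/
def quadPairing (u w : Quad n) : ℝ :=
  pairing u.1.1 w.1.1 - pairing u.1.2 w.1.2 + pairing u.2.1 w.2.1 - pairing u.2.2 w.2.2

/-- The classical r-matrix on quadruples that gives the second bracket. -/
def quadR (u : Quad n) : Quad n :=
  ((rPlus u.2.2 - rMinus u.2.1 - r u.1.1, -r u.1.2),
    (rPlus u.2.2 - r u.2.1 - rPlus u.1.1, r u.2.2 - rMinus u.2.1 - rMinus u.1.1))

/-- The infinitesimal action of quadruples by left and right multiplications. -/
def act (Y : Quad n) (x : E n) : E n :=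
  (Y.1.1 * x.1 - x.1 * Y.1.2, Y.2.1 * x.2 - x.2 * Y.2.2)

/-- The Lie bracket of quadruples. -/
def quadBracket (u w : Quad n) : Quad n :=
  ((u.1.1 * w.1.1 - w.1.1 * u.1.1, u.1.2 * w.1.2 - w.1.2 * u.1.2),
    (u.2.1 * w.2.1 - w.2.1 * u.2.1, u.2.2 * w.2.2 - w.2.2 * u.2.2))

theorem cot_act (β : Cot n) (Y : Quad n) (x : E n) :
    β (act Y x) = quadPairing (nablas x β) Y := by
  simp only [cot_apply, act, quadPairing, nablas_apply, pairing_sub_right]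
  rw [pairing_mul_cyclic x.1, pairing_mul_cyclic x.2, pairing_mul_left, pairing_mul_left]
  ring

theorem act_quadBracket (Y Z : Quad n) (x : E n) :
    act (quadBracket Y Z) x = act Y (act Z x) - act Z (act Y x) := by
  refine Prod.ext ?_ ?_ <;>
  · simp only [act, quadBracket, Prod.fst_sub, Prod.snd_sub]
    noncomm_ring

theorem quadPairing_quadBracket (u v w : Quad n) : quadPairing w (quadBracket u v)
    = triple u.1.1 v.1.1 w.1.1 - triple u.1.2 v.1.2 w.1.2
      + triple u.2.1 v.2.1 w.2.1 - triple u.2.2 v.2.2 w.2.2 := by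
  simp only [quadPairing, quadBracket, triple, pairing_comm w.1.1, pairing_comm w.1.2,
    pairing_comm w.2.1, pairing_comm w.2.2]

/-- The bilinear form on quadruples that defines the second bracket. -/
def quadForm (u w : Quad n) : ℝ := quadPairing u (quadR w)

theorem quadForm_antisymm (u w : Quad n) : quadForm u w = -quadForm w u := by
  simp only [quadForm, quadPairing, quadR, rPlus, rMinus, pairing_sub_right, pairing_add_right,
    pairing_neg_right, pairing_smul_right]
  rw [pairing_r_swap w.1.1 u.1.1, pairing_r_swap w.1.1 u.2.1, pairing_r_swap w.1.1 u.2.2,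
    pairing_r_swap w.1.2 u.1.2, pairing_r_swap w.2.1 u.2.1, pairing_r_swap w.2.1 u.2.2,
    pairing_r_swap w.2.1 u.1.1, pairing_r_swap w.2.2 u.2.2, pairing_r_swap w.2.2 u.1.1,
    pairing_r_swap w.2.2 u.2.1, pairing_comm w.1.1 u.2.1, pairing_comm w.1.1 u.2.2,
    pairing_comm w.2.1 u.1.1, pairing_comm w.2.1 u.2.2,
    pairing_comm w.2.2 u.1.1, pairing_comm w.2.2 u.2.1]
  ring

/-- The modified Yang-Baxter equation for `quadR`. Three components of `quadR u` involve `r` only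
through `r (u₂' - u₁ - u₂)`, and the remaining one is `-r u₁'`; this reduces the claim to the
equation for `r`, at the combinations `u₂' - u₁ - u₂` and at the components `u₁'`. -/
theorem quadR_yangBaxter (u v w : Quad n) :
    quadPairing w (quadBracket (quadR u) (quadR v))
      + quadPairing u (quadBracket (quadR v) (quadR w))
      + quadPairing v (quadBracket (quadR w) (quadR u))
    = -(1 / 4) * quadPairing w (quadBracket u v) := by
  have hR : ∀ z : Quad n, quadR z =
      ((r (z.2.2 - z.1.1 - z.2.1) + (1 / 2 : ℝ) • (z.2.2 + z.2.1), -r z.1.2),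
        (r (z.2.2 - z.1.1 - z.2.1) + (1 / 2 : ℝ) • (z.2.2 - z.1.1),
          r (z.2.2 - z.1.1 - z.2.1) + (1 / 2 : ℝ) • (z.2.1 + z.1.1))) := fun z => by
    simp only [quadR, rPlus, rMinus, r_sub, smul_add, smul_sub]
    refine Prod.ext (Prod.ext ?_ rfl) (Prod.ext ?_ ?_) <;> simp only <;> abel
  have h1 := triple_r (u.2.2 - u.1.1 - u.2.1) (v.2.2 - v.1.1 - v.2.1) (w.2.2 - w.1.1 - w.2.1)
  have h2 := triple_r u.1.2 v.1.2 w.1.2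
  simp only [quadPairing_quadBracket, hR]
  obtain ⟨⟨u1, u1'⟩, u2, u2'⟩ := u
  obtain ⟨⟨v1, v1'⟩, v2, v2'⟩ := v
  obtain ⟨⟨w1, w1'⟩, w2, w2'⟩ := w
  simp only at h1 h2 ⊢
  generalize r (u2' - u1 - u2) = a at *
  generalize r (v2' - v1 - v2) = b at *
  generalize r (w2' - w1 - w2) = c at *
  -- rotate every term so that its arguments come from `u`, `v`, `w` in this order
  have e1 : ∀ z B C : Mat n, triple B C z = triple z B C := fun z B C => (triple_cyclic z B C).symm
  have e2 : ∀ z C A : Mat n, triple C A z = triple A z C := fun z C A => triple_cyclic C A z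
  rw [e1 u1, e1 u1', e1 u2, e1 u2', e2 v1, e2 v1', e2 v2, e2 v2']
  simp only [triple_add_left, triple_add_mid, triple_add_right, triple_sub_left, triple_sub_mid,
    triple_sub_right, triple_neg_left, triple_neg_mid, triple_neg_right, triple_smul_left,
    triple_smul_mid, triple_smul_right] at h1 h2 ⊢
  linarith

theorem quadPairing_add_left (u u' w : Quad n) :
    quadPairing (u + u') w = quadPairing u w + quadPairing u' w := by
  simp only [quadPairing, Prod.fst_add, Prod.snd_add, pairing_add_left]; ring

theorem quadPairing_smul_left (c : ℝ) (u w : Quad n) :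
    quadPairing (c • u) w = c * quadPairing u w := by
  simp only [quadPairing, Prod.smul_fst, Prod.smul_snd, pairing_smul_left]; ring

theorem quadForm_add_left (u u' w : Quad n) :
    quadForm (u + u') w = quadForm u w + quadForm u' w :=
  quadPairing_add_left _ _ _

theorem quadForm_smul_left (c : ℝ) (u w : Quad n) :
    quadForm (c • u) w = c * quadForm u w :=
  quadPairing_smul_left _ _ _

/-- `quadForm` as a bilinear map. -/
def quadFormLin : Quad n →ₗ[ℝ] Quad n →ₗ[ℝ] ℝ :=
  LinearMap.mk₂ ℝ quadForm quadForm_add_left quadForm_smul_left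
    (fun u w w' => by
      rw [quadForm_antisymm, quadForm_add_left, quadForm_antisymm w, quadForm_antisymm w']; ring)
    (fun c u w => by
      rw [quadForm_antisymm, quadForm_smul_left, quadForm_antisymm w, smul_eq_mul]; ring)

/-- The tensor of the second bracket for fixed covectors, as a bilinear form in the base point. -/
def polar2 (α β : Cot n) : E n →ₗ[ℝ] E n →ₗ[ℝ] ℝ :=
  quadFormLin.compl₁₂ (nablas.flip α) (nablas.flip β)

/-- The tensor of the second bracket. -/
def tensor2 (x : E n) : Cot n →L[ℝ] Cot n →L[ℝ] ℝ :=
  (quadFormLin.compl₁₂ (nablas x) (nablas x)).toContinuousBilinearMap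

/-- Hamiltonian vectors for the second bracket. -/
def ham2 (x : E n) (α : Cot n) : E n := act (quadR (nablas x α)) x

theorem tensor2_apply (x : E n) (α β : Cot n) :
    tensor2 x α β = quadForm (nablas x α) (nablas x β) := rfl

theorem fderiv_tensor2 (x v : E n) (α β : Cot n) : fderiv ℝ tensor2 x v α β
    = quadForm (nablas v α) (nablas x β) + quadForm (nablas x α) (nablas v β) := by
  have h := fderiv_toContinuousBilinearMap
    (q := fun x : E n => quadFormLin.compl₁₂ (nablas x) (nablas x))
    (fun α β => contDiff_diagonal (polar2 α β)) x v α β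
  exact h.trans (fderiv_diagonal (polar2 α β) x v)

theorem isPoissonTensor2 : IsPoissonTensor (tensor2 (n := n)) ham2 where
  smooth := contDiff_toContinuousBilinearMap fun α β => contDiff_diagonal (polar2 α β)
  antisymm x α β := quadForm_antisymm _ _
  ham_spec x α β := cot_act _ _ _
  schouten x α β γ := by
    have key : ∀ α β γ : Cot n, fderiv ℝ tensor2 x (ham2 x α) β γ
        = β (act (quadR (nablas x γ)) (act (quadR (nablas x α)) x))
          - γ (act (quadR (nablas x β)) (act (quadR (nablas x α)) x)) := fun α β γ => by
      rw [fderiv_tensor2, quadForm_antisymm (nablas x β), cot_act, cot_act]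
      rfl
    have yb := quadR_yangBaxter (nablas x α) (nablas x β) (nablas x γ)
    -- on the derivatives of functions the right-hand side vanishes, by cyclicity of the trace
    rw [quadPairing_quadBracket (nablas x α) (nablas x β)] at yb
    simp only [← cot_act, act_quadBracket, map_sub] at yb
    have h1 := triple_mul_comm (gradG α) (gradG β) (gradG γ) x.1
    have h2 := triple_mul_comm (gradJ α) (gradJ β) (gradJ γ) x.2
    rw [key, key, key]
    simp only [nablas_apply] at yb ⊢
    linarith

theorem pairing_mul_mul_swap (J D D' : Mat n) :
    pairing (J * D) (J * D') = pairing (D * J) (D' * J) := by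
  rw [pairing_mul_cyclic, pairing_mul_left D, mul_assoc]

/-- The formula of the second bracket is given by the tensor `tensor2`. The two agree by the
antisymmetry of `r` and by `⟨∇₂F, ∇₂H⟩ = ⟨∇₂'F, ∇₂'H⟩`. -/
theorem bracket2_eq {F H : M n → ℝ} {x : M n} (hF : DifferentiableAt ℝ (coordFn F) (emb x))
    (hH : DifferentiableAt ℝ (coordFn H) (emb x)) :
    bracket2 F H x = tensor2 (emb x) (fderiv ℝ (coordFn F) (emb x))
      (fderiv ℝ (coordFn H) (emb x)) := by
  have h := pairing_mul_mul_swap x.2 (d2 F x) (d2 H x)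
  rw [tensor2_apply, quadForm, nablas_apply, nablas_apply]
  simp only [bracket2, nabla2, nabla2', nabla1_eq hF, nabla1_eq hH, nabla1'_eq hF, nabla1'_eq hH,
    d2_eq hF, d2_eq hH, quadPairing, quadR, rPlus, rMinus] at h ⊢
  generalize fderiv ℝ (coordFn F) (emb x) = α at *
  generalize fderiv ℝ (coordFn H) (emb x) = β at *
  simp only [emb, pairing_sub_right, pairing_sub_left, pairing_add_right, pairing_neg_right,
    pairing_smul_right, pairing_r_left]
  rw [pairing_r_swap ((x.1 : Mat n) * gradG β) (x.2 * gradJ α),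
    pairing_r_swap ((x.1 : Mat n) * gradG β) (gradJ α * x.2),
    pairing_comm ((x.1 : Mat n) * gradG β) (x.2 * gradJ α),
    pairing_comm ((x.1 : Mat n) * gradG β) (gradJ α * x.2)]
  linarith

/-! ### Linear functions -/

/-- The second bracket of two linear functions is a quadratic form. -/
theorem bracket2_linear (φ χ : E n →ₗ[ℝ] ℝ) : ∃ Q : QuadraticForm ℝ (E n), ∀ x : M n,
    bracket2 (fun y => φ ((y.1 : Mat n), y.2)) (fun y => χ ((y.1 : Mat n), y.2)) x
      = Q ((x.1 : Mat n), x.2) := by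
  have hd : ∀ (φ : E n →ₗ[ℝ] ℝ) (x : M n), HasFDerivAt
      (coordFn fun y : M n => φ ((y.1 : Mat n), y.2)) (LinearMap.toContinuousLinearMap φ)
      (emb x) := fun φ x => by
    refine ((LinearMap.toContinuousLinearMap φ).hasFDerivAt (x := emb x)).congr_of_eventuallyEq ?_
    filter_upwards [eventually_mem_range_emb x] with z ⟨y, hy⟩
    rw [← hy, coordFn_emb]
    rfl
  refine ⟨LinearMap.BilinMap.toQuadraticMap (polar2 (LinearMap.toContinuousLinearMap φ)
    (LinearMap.toContinuousLinearMap χ)), fun x => ?_⟩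
  rw [bracket2_eq (hd φ x).differentiableAt (hd χ x).differentiableAt, (hd φ x).fderiv,
    (hd χ x).fderiv]
  rfl

/-! ### The canonical bracket of the cotangent bundle -/

theorem fderiv_liouville (x a : Mat n × (Mat n →L[ℝ] ℝ)) (b : Mat n × (Mat n →L[ℝ] ℝ)) :
    fderiv ℝ liouville x a b = a.2 b.1 := by
  have h := (((ContinuousLinearMap.compL ℝ (Mat n × (Mat n →L[ℝ] ℝ)) (Mat n) ℝ).flip
    (ContinuousLinearMap.fst ℝ (Mat n) (Mat n →L[ℝ] ℝ))).comp
    (ContinuousLinearMap.snd ℝ (Mat n) (Mat n →L[ℝ] ℝ))).hasFDerivAt (x := x)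
  replace h := h.congr_of_eventuallyEq (f₁ := liouville) (Filter.Eventually.of_forall fun _ => rfl)
  rw [h.fderiv]
  rfl

theorem canonicalForm_apply (x a b : Mat n × (Mat n →L[ℝ] ℝ)) :
    canonicalForm x a b = b.2 a.1 - a.2 b.1 := by
  rw [canonicalForm, fderiv_liouville, fderiv_liouville]

theorem canonicalForm_left_injective {x a a' : Mat n × (Mat n →L[ℝ] ℝ)}
    (h : ∀ b, canonicalForm x a b = canonicalForm x a' b) : a = a' := by
  simp only [canonicalForm_apply] at h
  refine Prod.ext ?_ ?_
  · refine pairing_left_injective fun X => ?_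
    have h1 := h (0, LinearMap.toContinuousLinearMap (pairingLin X))
    simp only [map_zero, sub_zero, LinearMap.coe_toContinuousLinearMap', pairingLin_apply] at h1
    rw [pairing_comm, h1, pairing_comm]
  · ext v
    have h1 := h (v, 0)
    simpa using h1

/-- The covector `⟨Y, ·⟩`, depending linearly and continuously on `Y`. -/
def pairingCLM : Mat n →L[ℝ] Mat n →L[ℝ] ℝ := pairingLin.toContinuousBilinearMap

theorem pairingCLM_apply (X Y : Mat n) : pairingCLM X Y = pairing X Y := rfl

theorem dualVec_pairingCLM (Y : Mat n) : dualVec (pairingCLM Y) = Y :=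
  pairing_left_injective fun X => by rw [pairing_dualVec, pairingCLM_apply]

theorem pairingCLM_dualVec (φ : Mat n →L[ℝ] ℝ) : pairingCLM (dualVec φ) = φ := by
  ext X
  rw [pairingCLM_apply, pairing_dualVec]

section Trivialization

variable {W : Type*} [NormedAddCommGroup W] [NormedSpace ℝ W]

theorem contMDiff_mul_matrix {M' H' E' : Type*} [NormedAddCommGroup E'] [NormedSpace ℝ E']
    [TopologicalSpace H'] {I : ModelWithCorners ℝ E' H'} [TopologicalSpace M'] [ChartedSpace H' M']
    {a b : M' → Mat n} (ha : ContMDiff I 𝓘(ℝ, Mat n) ∞ a) (hb : ContMDiff I 𝓘(ℝ, Mat n) ∞ b) :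
    ContMDiff I 𝓘(ℝ, Mat n) ∞ fun x => a x * b x :=
  (contDiff_mul (𝕜 := ℝ) (𝔸 := Mat n)).contMDiff.comp (ha.prodMk_space hb)

theorem contMDiff_coe_fst : ContMDiff ((𝓘(ℝ, Mat n)).prod 𝓘(ℝ, W)) 𝓘(ℝ, Mat n) ∞
    (fun x : GL (Fin n) ℂ × W => (x.1 : Mat n)) :=
  Units.contMDiff_val.comp contMDiff_fst

theorem contMDiff_coe_inv_fst : ContMDiff ((𝓘(ℝ, Mat n)).prod 𝓘(ℝ, W)) 𝓘(ℝ, Mat n) ∞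
    (fun x : GL (Fin n) ℂ × W => ((x.1⁻¹ : GL (Fin n) ℂ) : Mat n)) :=
  Units.contMDiff_val.comp ((contMDiff_inv 𝓘(ℝ, Mat n) ∞).comp contMDiff_fst)

/-- The right trivialization of the cotangent bundle, `(g, J) ↦ ⟨g⁻¹ J, ·⟩`. -/
def trivialization : M n ≃ₘ^∞⟮IM n, ICot n⟯ CotangentGL n where
  toFun x := (x.1, pairingCLM (((x.1⁻¹ : GL (Fin n) ℂ) : Mat n) * x.2))
  invFun y := (y.1, (y.1 : Mat n) * dualVec y.2)
  left_inv x := by simp [dualVec_pairingCLM, ← mul_assoc]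
  right_inv y := by simp [pairingCLM_dualVec, ← mul_assoc]
  contMDiff_toFun := contMDiff_fst.prodMk
    (pairingCLM.contMDiff.comp (contMDiff_mul_matrix contMDiff_coe_inv_fst contMDiff_snd))
  contMDiff_invFun := contMDiff_fst.prodMk
    (contMDiff_mul_matrix contMDiff_coe_fst
      ((LinearMap.toContinuousLinearMap dualVec).contMDiff.comp contMDiff_snd))

theorem trivialization_apply (x : M n) : trivialization x
    = (x.1, pairingCLM (((x.1⁻¹ : GL (Fin n) ℂ) : Mat n) * x.2)) := rfl

theorem trivialization_snd (g : GL (Fin n) ℂ) (J v : Mat n) :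
    (trivialization (g, J)).2 v = pairing J (v * ((g⁻¹ : GL (Fin n) ℂ) : Mat n)) := by
  rw [trivialization_apply, pairingCLM_apply, pairing_mul_cyclic]

/-- The inclusion of `T^*GL(n,ℂ)` into its ambient vector space. -/
def embCot (x : CotangentGL n) : Mat n × (Mat n →L[ℝ] ℝ) := ((x.1 : Mat n), x.2)

/-- A function on `T^*GL(n,ℂ)` as a function on the ambient vector space. -/
def coordCot (f : CotangentGL n → ℝ) (z : Mat n × (Mat n →L[ℝ] ℝ)) : ℝ := f (toGL z.1, z.2)

theorem coordCot_embCot (f : CotangentGL n → ℝ) (x : CotangentGL n) :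
    coordCot f (embCot x) = f x := by
  simp [coordCot, embCot, toGL_coe]

theorem contMDiffAt_retractCot (x : CotangentGL n) :
    ContMDiffAt 𝓘(ℝ, Mat n × (Mat n →L[ℝ] ℝ)) (ICot n) ∞
      (fun z => ((toGL z.1, z.2) : CotangentGL n)) (embCot x) :=
  ((contMDiffAt_toGL x.1).comp (embCot x) contDiff_fst.contMDiff.contMDiffAt).prodMk
    contDiff_snd.contMDiff.contMDiffAt

theorem differentiableAt_coordCot (f : C^∞⟮ICot n, CotangentGL n; ℝ⟯) (x : CotangentGL n) :
    DifferentiableAt ℝ (coordCot f) (embCot x) := by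
  refine ContDiffAt.differentiableAt (n := ∞) ?_ (by simp)
  rw [← contMDiffAt_iff_contDiffAt]
  exact ContMDiffAt.comp (embCot x) (I' := ICot n) (g := f) f.contMDiff.contMDiffAt
    (contMDiffAt_retractCot x)

/-- The chart of `GL(n,ℂ)` is the inclusion into matrices, so the derivative on the manifold is that
of the function in matrix coordinates. -/
theorem mfderiv_eq_fderiv_coordCot (f : C^∞⟮ICot n, CotangentGL n; ℝ⟯) (x : CotangentGL n)
    (a : Mat n × (Mat n →L[ℝ] ℝ)) :
    mfderiv (ICot n) 𝓘(ℝ, ℝ) f x a = fderiv ℝ (coordCot f) (embCot x) a := by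
  have h1 : writtenInExtChartAt (ICot n) 𝓘(ℝ, ℝ) x f =ᶠ[nhds (embCot x)] coordCot f := by
    have hz : ∀ᶠ z in nhds (embCot x), IsUnit z.1 :=
      (continuous_fst.tendsto (embCot x)).eventually (eventually_isUnit x.1)
    filter_upwards [hz] with z hz
    have h2 : (chartAt (Mat n) x.1).symm z.1 = toGL z.1 := by
      have h3 := (chartAt (Mat n) x.1).left_inv (x := toGL z.1) (by simp)
      rwa [Units.chartAt_apply, coe_toGL hz] at h3
    change f ((chartAt (Mat n) x.1).symm z.1, z.2) = _
    rw [h2, coordCot]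
  have h2 : HasMFDerivAt (ICot n) 𝓘(ℝ, ℝ) f x (fderiv ℝ (coordCot f) (embCot x)) :=
    ⟨f.contMDiff.continuous.continuousAt,
      ((differentiableAt_coordCot f x).hasFDerivAt.congr_of_eventuallyEq h1).hasFDerivWithinAt⟩
  rw [h2.mfderiv]
  rfl

/-- The chain rule for a curve in `M` and a function on `T^*GL(n,ℂ)`. -/
theorem hasDerivAt_comp_trivialization (f : C^∞⟮ICot n, CotangentGL n; ℝ⟯) {x : M n}
    {γ : ℝ → M n} {v : Mat n × (Mat n →L[ℝ] ℝ)} (h0 : γ 0 = x)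
    (hγ : HasDerivAt (fun t => embCot (trivialization (γ t))) v 0) :
    HasDerivAt (fun t => (f ∘ trivialization) (γ t))
      (fderiv ℝ (coordCot f) (embCot (trivialization x)) v) 0 := by
  have h : HasFDerivAt (coordCot f) (fderiv ℝ (coordCot f) (embCot (trivialization x)))
      (embCot (trivialization (γ 0))) := by
    rw [h0]; exact (differentiableAt_coordCot f _).hasFDerivAt
  have h2 := h.comp_hasDerivAt (0 : ℝ) hγ
  simpa only [Function.comp_def, coordCot_embCot] using h2

/-- The derivative of a function on `T^*GL(n,ℂ)` along the base, as a matrix. -/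
def baseGrad (α : Mat n × (Mat n →L[ℝ] ℝ) →L[ℝ] ℝ) : Mat n :=
  dualVec (α.comp (ContinuousLinearMap.inl ℝ (Mat n) (Mat n →L[ℝ] ℝ)))

/-- The derivative of a function on `T^*GL(n,ℂ)` along the fibre, as a matrix. -/
def fibreGrad (α : Mat n × (Mat n →L[ℝ] ℝ) →L[ℝ] ℝ) : Mat n :=
  dualVec ((α.comp (ContinuousLinearMap.inr ℝ (Mat n) (Mat n →L[ℝ] ℝ))).comp pairingCLM)

theorem cotangent_apply (α : Mat n × (Mat n →L[ℝ] ℝ) →L[ℝ] ℝ) (a : Mat n × (Mat n →L[ℝ] ℝ)) :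
    α a = pairing (baseGrad α) a.1 + a.2 (fibreGrad α) := by
  obtain ⟨v, π⟩ := a
  have h : π (fibreGrad α) = α (0, π) := by
    nth_rw 1 [← pairingCLM_dualVec π]
    rw [pairingCLM_apply, pairing_comm, fibreGrad, pairing_dualVec, ContinuousLinearMap.comp_apply,
      pairingCLM_dualVec]
    rfl
  rw [h, baseGrad, pairing_dualVec]
  simp [← map_add]

theorem hamiltonianField_eq (f : C^∞⟮ICot n, CotangentGL n; ℝ⟯) (x : CotangentGL n) :
    hamiltonianField f x = (fibreGrad (fderiv ℝ (coordCot f) (embCot x)),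
      -pairingCLM (baseGrad (fderiv ℝ (coordCot f) (embCot x)))) := by
  have h : ∀ a, canonicalForm ((x.1 : Mat n), x.2)
      (fibreGrad (fderiv ℝ (coordCot f) (embCot x)),
        -pairingCLM (baseGrad (fderiv ℝ (coordCot f) (embCot x)))) a
      = mfderiv (ICot n) 𝓘(ℝ, ℝ) f x a := fun a => by
    rw [mfderiv_eq_fderiv_coordCot, canonicalForm_apply, cotangent_apply]
    simp [pairingCLM_apply, add_comm]
  refine canonicalForm_left_injective (x := ((x.1 : Mat n), x.2)) fun a => ?_
  rw [h]
  exact gradientWrt_spec ⟨_, h⟩ a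

theorem canonicalBracket_eq (f h : C^∞⟮ICot n, CotangentGL n; ℝ⟯) (x : CotangentGL n) :
    canonicalBracket f h x
      = pairing (baseGrad (fderiv ℝ (coordCot f) (embCot x)))
          (fibreGrad (fderiv ℝ (coordCot h) (embCot x)))
        - pairing (baseGrad (fderiv ℝ (coordCot h) (embCot x)))
          (fibreGrad (fderiv ℝ (coordCot f) (embCot x))) := by
  rw [canonicalBracket, hamiltonianField_eq, hamiltonianField_eq, canonicalForm_apply]
  simp only [neg_apply, pairingCLM_apply]
  ring

theorem hasDerivAt_pairingCLM {m : ℝ → Mat n} {m' : Mat n} {t : ℝ} (hm : HasDerivAt m m' t) :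
    HasDerivAt (fun s => pairingCLM (m s)) (pairingCLM m') t :=
  pairingCLM.hasFDerivAt.comp_hasDerivAt t hm

theorem coe_expGL_inv (X : Mat n) (t : ℝ) :
    (((expGL (t • X))⁻¹ : GL (Fin n) ℂ) : Mat n) = expGL (t • -X) := by
  rw [smul_neg]; rfl

theorem nabla1_comp_trivialization (f : C^∞⟮ICot n, CotangentGL n; ℝ⟯) (x : M n) :
    nabla1 (f ∘ trivialization) x
      = x.1 * baseGrad (fderiv ℝ (coordCot f) (embCot (trivialization x)))
        - x.2 * (fibreGrad (fderiv ℝ (coordCot f) (embCot (trivialization x)))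
          * ((x.1⁻¹ : GL (Fin n) ℂ) : Mat n)) := by
  refine gradientWrt_pairing_eq fun X => ?_
  have h : HasDerivAt (fun t : ℝ => embCot (trivialization (expGL (t • X) * x.1, x.2)))
      (X * (x.1 : Mat n), pairingCLM (((x.1⁻¹ : GL (Fin n) ℂ) : Mat n) * -X * x.2)) 0 := by
    have h1 := hasDerivAt_pairingCLM
      (((hasDerivAt_expGL (-X)).const_mul ((x.1⁻¹ : GL (Fin n) ℂ) : Mat n)).mul_const x.2)
    have h2 : (fun t : ℝ => embCot (trivialization (expGL (t • X) * x.1, x.2)))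
        = fun t : ℝ => ((expGL (t • X) : Mat n) * (x.1 : Mat n),
          pairingCLM (((x.1⁻¹ : GL (Fin n) ℂ) : Mat n) * (expGL (t • -X) : Mat n) * x.2)) := by
      funext t
      rw [trivialization_apply, embCot, mul_inv_rev, Units.val_mul, Units.val_mul, coe_expGL_inv]
    rw [h2]
    exact ((hasDerivAt_expGL X).mul_const (x.1 : Mat n)).prodMk h1
  rw [(hasDerivAt_comp_trivialization f (x := x) (γ := fun t => (expGL (t • X) * x.1, x.2))
    (by simp [expGL_zero]) h).deriv]
  generalize fderiv ℝ (coordCot f) (embCot (trivialization x)) = α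
  rw [cotangent_apply, pairingCLM_apply, pairing_sub_left, pairing_mul_cyclic, mul_neg, neg_mul,
    pairing_neg_left, ← sub_eq_add_neg, mul_assoc, pairing_mul_cyclic, pairing_mul_left,
    pairing_mul_left, pairing_comm, pairing_mul_left,
    pairing_comm ((x.1⁻¹ : GL (Fin n) ℂ) : Mat n), pairing_mul_cyclic (X * x.2)]

theorem d2_comp_trivialization (f : C^∞⟮ICot n, CotangentGL n; ℝ⟯) (x : M n) :
    d2 (f ∘ trivialization) x
      = fibreGrad (fderiv ℝ (coordCot f) (embCot (trivialization x)))
          * ((x.1⁻¹ : GL (Fin n) ℂ) : Mat n) := by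
  refine gradientWrt_pairing_eq fun X => ?_
  have h : HasDerivAt (fun t : ℝ => embCot (trivialization (x.1, x.2 + t • X)))
      (0, pairingCLM (((x.1⁻¹ : GL (Fin n) ℂ) : Mat n) * X)) 0 := by
    have h0 : HasDerivAt (fun t : ℝ => x.2 + t • X) ((1 : ℝ) • X) 0 :=
      ((hasDerivAt_id (0 : ℝ)).smul_const X).const_add x.2
    rw [one_smul] at h0
    have h1 := hasDerivAt_pairingCLM (h0.const_mul ((x.1⁻¹ : GL (Fin n) ℂ) : Mat n))
    exact (hasDerivAt_const (0 : ℝ) (x.1 : Mat n)).prodMk h1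
  rw [(hasDerivAt_comp_trivialization f (x := x) (γ := fun t => (x.1, x.2 + t • X))
    (by rw [zero_smul, add_zero]) h).deriv]
  rw [cotangent_apply, pairingCLM_apply, pairing_comm (_ * X), pairing_mul_left]
  simp [pairing]

/-- The first bracket is the canonical bracket of the cotangent bundle. -/
theorem bracket1_comp_trivialization (f h : C^∞⟮ICot n, CotangentGL n; ℝ⟯) (x : M n) :
    bracket1 (f ∘ trivialization) (h ∘ trivialization) x
      = canonicalBracket f h (trivialization x) := by
  rw [canonicalBracket_eq, bracket1, nabla1_comp_trivialization, nabla1_comp_trivialization,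
    d2_comp_trivialization, d2_comp_trivialization]
  generalize fderiv ℝ (coordCot f) (embCot (trivialization x)) = α
  generalize fderiv ℝ (coordCot h) (embCot (trivialization x)) = β
  have key : ∀ a u : Mat n, pairing ((x.1 : Mat n) * a) (u * ((x.1⁻¹ : GL (Fin n) ℂ) : Mat n))
      = pairing a u := fun a u => by
    rw [pairing_mul_cyclic, mul_assoc]; simp
  simp only [pairing_sub_left, pairing_sub_right, key, pairing_mul_left]
  ring

end Trivialization

/-! ### Triangular factorization near the identity -/

theorem rPlus_apply (X : Mat n) (i j : Fin n) : rPlus X i j =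
    if i < j then X i j else if j < i then 0 else (1 / 2 : ℂ) * X i j := by
  rw [rPlus, Matrix.add_apply, r_apply, Matrix.smul_apply, Complex.real_smul]
  split_ifs <;> push_cast <;> ring

theorem rMinus_apply (X : Mat n) (i j : Fin n) : rMinus X i j =
    if i < j then 0 else if j < i then -X i j else -(1 / 2 : ℂ) * X i j := by
  rw [rMinus, Matrix.sub_apply, r_apply, Matrix.smul_apply, Complex.real_smul]
  split_ifs <;> push_cast <;> ring

/-- `b` is upper triangular, `c` is lower triangular, and their diagonals agree. The pairs
`(b, c⁻¹)` with `b`, `c` invertible make up the dual group. -/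
structure IsTriangularPair (b c : Mat n) : Prop where
  upper : b.BlockTriangular id
  lower : c.BlockTriangular OrderDual.toDual
  diag : ∀ i, b i i = c i i

theorem isTriangularPair_r (X : Mat n) : IsTriangularPair (1 + rPlus X) (1 - rMinus X) where
  upper i j h := by
    have h' : j < i := h
    simp [rPlus_apply, h', h'.not_gt, h'.ne']
  lower i j h := by
    have h' : i < j := h
    simp [rMinus_apply, h', h'.ne]
  diag i := by
    simp only [Matrix.add_apply, Matrix.sub_apply, rPlus_apply, rMinus_apply, lt_irrefl, if_false]
    ring

/-- The decomposition of a matrix into an upper and a lower triangular part with opposite diagonals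
is unique. -/
theorem rPlus_sub_of_triangular {U L : Mat n} (hU : U.BlockTriangular id)
    (hL : L.BlockTriangular OrderDual.toDual) (hd : ∀ i, U i i = -L i i) :
    rPlus (U - L) = U := by
  ext i j
  rw [rPlus_apply, Matrix.sub_apply]
  rcases lt_trichotomy i j with h | rfl | h
  · have h1 : L i j = 0 := hL h
    simp [h, h1]
  · simp only [lt_irrefl, if_false, hd]; ring
  · have h1 : U i j = 0 := hU h
    simp [h, h.not_gt, h1]

theorem rMinus_sub_of_triangular {U L : Mat n} (hU : U.BlockTriangular id)
    (hL : L.BlockTriangular OrderDual.toDual) (hd : ∀ i, U i i = -L i i) :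
    rMinus (U - L) = L := by
  have h1 := rPlus_sub_rMinus (U - L)
  rw [rPlus_sub_of_triangular hU hL hd, sub_right_inj] at h1
  exact h1

/-- A triangular pair `(b, c)` has the form `(1 + r₊ X, 1 - r₋ X)` with `X = b + c - 2`. -/
theorem IsTriangularPair.r_eq {b c : Mat n} (h : IsTriangularPair b c) :
    1 + rPlus (b + c - 2) = b ∧ 1 - rMinus (b + c - 2) = c := by
  have hU : (b - 1).BlockTriangular id := h.upper.sub Matrix.blockTriangular_one
  have hL : (1 - c).BlockTriangular OrderDual.toDual := Matrix.blockTriangular_one.sub h.lower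
  have hd : ∀ i, (b - 1) i i = -(1 - c) i i := fun i => by
    simp only [Matrix.sub_apply, h.diag]; ring
  have e : b + c - 2 = (b - 1) - (1 - c) := by rw [← one_add_one_eq_two]; abel
  rw [e, rPlus_sub_of_triangular hU hL hd, rMinus_sub_of_triangular hU hL hd]
  exact ⟨add_sub_cancel _ _, sub_sub_cancel _ _⟩

theorem upper_mul_diag {A B : Mat n} (hA : A.BlockTriangular id) (hB : B.BlockTriangular id)
    (i : Fin n) : (A * B) i i = A i i * B i i := by
  rw [Matrix.mul_apply]
  refine Finset.sum_eq_single i (fun j _ hj => ?_) (by simp)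
  rcases lt_or_gt_of_ne hj with h | h
  · rw [show A i j = 0 from hA h, zero_mul]
  · rw [show B j i = 0 from hB h, mul_zero]

theorem lower_mul_diag {A B : Mat n} (hA : A.BlockTriangular OrderDual.toDual)
    (hB : B.BlockTriangular OrderDual.toDual) (i : Fin n) : (A * B) i i = A i i * B i i := by
  rw [Matrix.mul_apply]
  refine Finset.sum_eq_single i (fun j _ hj => ?_) (by simp)
  rcases lt_or_gt_of_ne hj with h | h
  · rw [show B j i = 0 from hB h, mul_zero]
  · rw [show A i j = 0 from hA h, zero_mul]

theorem blockTriangular_coe_inv {α : Type*} [LinearOrder α] {b : Fin n → α} {g : GL (Fin n) ℂ}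
    (hg : (g : Mat n).BlockTriangular b) : ((g⁻¹ : GL (Fin n) ℂ) : Mat n).BlockTriangular b := by
  let _ := g.invertible
  rw [Matrix.coe_units_inv]
  exact Matrix.blockTriangular_inv_of_blockTriangular hg

theorem upper_inv_diag {g : GL (Fin n) ℂ} (hg : (g : Mat n).BlockTriangular id) (i : Fin n) :
    (g : Mat n) i i * ((g⁻¹ : GL (Fin n) ℂ) : Mat n) i i = 1 := by
  rw [← upper_mul_diag hg (blockTriangular_coe_inv hg)]; simp

theorem lower_inv_diag {g : GL (Fin n) ℂ} (hg : (g : Mat n).BlockTriangular OrderDual.toDual)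
    (i : Fin n) : (g : Mat n) i i * ((g⁻¹ : GL (Fin n) ℂ) : Mat n) i i = 1 := by
  rw [← lower_mul_diag hg (blockTriangular_coe_inv hg)]; simp

theorem IsTriangularPair.inv_diag {b c : GL (Fin n) ℂ} (h : IsTriangularPair (b : Mat n) c)
    (i : Fin n) : ((b⁻¹ : GL (Fin n) ℂ) : Mat n) i i = ((c⁻¹ : GL (Fin n) ℂ) : Mat n) i i := by
  have h1 := upper_inv_diag h.upper i
  have h2 := lower_inv_diag h.lower i
  rw [← h.diag] at h2
  exact mul_left_cancel₀ (left_ne_zero_of_mul_eq_one h1) (h1.trans h2.symm)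

theorem IsTriangularPair.inv {b c : GL (Fin n) ℂ} (h : IsTriangularPair (b : Mat n) c) :
    IsTriangularPair ((b⁻¹ : GL (Fin n) ℂ) : Mat n) ((c⁻¹ : GL (Fin n) ℂ) : Mat n) where
  upper := blockTriangular_coe_inv h.upper
  lower := blockTriangular_coe_inv h.lower
  diag := h.inv_diag

/-- An invertible triangular pair has the form `(η_> η₀, η₀ η_<)`. -/
theorem IsTriangularPair.exists_triple {b c : GL (Fin n) ℂ} (h : IsTriangularPair (b : Mat n) c) :
    ∃ u d l : GL (Fin n) ℂ, IsTriangularTriple u d l ∧ b = u * d ∧ c = d * l := by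
  have hb := fun i => upper_inv_diag h.upper i
  let d : GL (Fin n) ℂ :=
    ⟨Matrix.diagonal fun i => (b : Mat n) i i,
      Matrix.diagonal fun i => ((b⁻¹ : GL (Fin n) ℂ) : Mat n) i i,
      by rw [Matrix.diagonal_mul_diagonal]; simp only [hb, Matrix.diagonal_one],
      by rw [Matrix.diagonal_mul_diagonal]; simp only [mul_comm, hb, Matrix.diagonal_one]⟩
  have hd : (d : Mat n) = Matrix.diagonal fun i => (b : Mat n) i i := rfl
  have hd' : ((d⁻¹ : GL (Fin n) ℂ) : Mat n)
      = Matrix.diagonal fun i => ((b⁻¹ : GL (Fin n) ℂ) : Mat n) i i := rfl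
  refine ⟨b * d⁻¹, d, d⁻¹ * c, ⟨fun i j hij => ?_, fun i => ?_, fun i j hij => ?_,
    fun i j hij => ?_, fun i => ?_⟩, by group, by group⟩
  · rw [Units.val_mul, hd', Matrix.mul_diagonal, show (b : Mat n) i j = 0 from h.upper hij,
      zero_mul]
  · rw [Units.val_mul, hd', Matrix.mul_diagonal, hb]
  · rw [hd, Matrix.diagonal_apply_ne _ hij]
  · rw [Units.val_mul, hd', Matrix.diagonal_mul, show (c : Mat n) i j = 0 from h.lower hij,
      mul_zero]
  · rw [Units.val_mul, hd', Matrix.diagonal_mul, ← h.diag, mul_comm, hb]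

/-- `rPlus` as a continuous linear map. -/
def rPlusCLM : Mat n →L[ℝ] Mat n :=
  LinearMap.toContinuousLinearMap (rLin + (1 / 2 : ℝ) • LinearMap.id)

/-- `rMinus` as a continuous linear map. -/
def rMinusCLM : Mat n →L[ℝ] Mat n :=
  LinearMap.toContinuousLinearMap (rLin - (1 / 2 : ℝ) • LinearMap.id)

/-- Near the identity a matrix `A` has a unique factorization into a triangular pair close to
`(1, 1)`, which depends smoothly on `A`: by the inverse function theorem for the polynomial map
`X ↦ (1 + r₊ X) (1 - r₋ X)`, whose derivative at `0` is the identity because `r₊ - r₋ = id`. -/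
theorem exists_factorization (n : ℕ) : ∃ e : OpenPartialHomeomorph (Mat n) (Mat n),
    1 ∈ e.source ∧ e 1 = 0 ∧ ContDiffOn ℝ ∞ e e.source ∧
    ∀ X, e.symm X = (1 + rPlus X) * (1 - rMinus X) := by
  set P : Mat n → Mat n := fun X => (1 + rPlusCLM X) * (1 - rMinusCLM X) with hP
  have hc : ContDiffAt ℝ ω P 0 :=
    ((contDiff_const.add rPlusCLM.contDiff).mul (contDiff_const.sub rMinusCLM.contDiff)).contDiffAt
  have hd : HasFDerivAt P ((ContinuousLinearEquiv.refl ℝ (Mat n) : Mat n ≃L[ℝ] Mat n) :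
      Mat n →L[ℝ] Mat n) 0 := by
    have h := ((rPlusCLM (n := n)).hasFDerivAt.const_add (1 : Mat n) (x := 0)).mul'
      ((rMinusCLM (n := n)).hasFDerivAt.const_sub (1 : Mat n) (x := 0))
    convert! h using 1
    ext1 X
    have h1 : rPlusCLM X - rMinusCLM X = X := rPlus_sub_rMinus X
    simp [← sub_eq_neg_add, h1]
  have h0 : P 0 = 1 := by simp [hP]
  have hn : (ω : WithTop ℕ∞) ≠ 0 := by simp
  have hs := hc.to_localInverse hd hn
  set e₀ := hc.toOpenPartialHomeomorph P hd hn with he₀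
  have hs' : ContDiffAt ℝ ω e₀.symm 1 := h0 ▸ hs
  have ht : (1 : Mat n) ∈ e₀.target := by
    rw [← h0]; exact hc.image_mem_toOpenPartialHomeomorph_target hd hn
  obtain ⟨V, hV, hVo, h1V⟩ := eventually_nhds_iff.1 (hs'.eventually (by simp))
  refine ⟨e₀.symm.restrOpen V hVo, ⟨ht, h1V⟩, ?_, ?_, fun X => rfl⟩
  · have h := e₀.left_inv (hc.mem_toOpenPartialHomeomorph_source hd hn)
    have h2 : e₀ 0 = 1 := h0
    rw [h2] at h
    exact h
  · exact fun A hA => ((hV A hA.2).of_le le_top).contDiffWithinAt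

/-- A local inverse of `X ↦ (1 + r₊ X) (1 - r₋ X)` near the identity matrix. -/
def gaussChart (n : ℕ) : OpenPartialHomeomorph (Mat n) (Mat n) :=
  (exists_factorization n).choose

theorem one_mem_gaussChart_source : 1 ∈ (gaussChart n).source :=
  (exists_factorization n).choose_spec.1

theorem gaussChart_one : gaussChart n 1 = 0 :=
  (exists_factorization n).choose_spec.2.1

theorem contDiffOn_gaussChart : ContDiffOn ℝ ∞ (gaussChart n) (gaussChart n).source :=
  (exists_factorization n).choose_spec.2.2.1

theorem gaussChart_symm (X : Mat n) :
    (gaussChart n).symm X = (1 + rPlus X) * (1 - rMinus X) :=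
  (exists_factorization n).choose_spec.2.2.2 X

/-- The upper triangular factor of a matrix near the identity. -/
def upperFactor (A : Mat n) : Mat n := 1 + rPlus (gaussChart n A)

/-- The lower triangular factor of a matrix near the identity. -/
def lowerFactor (A : Mat n) : Mat n := 1 - rMinus (gaussChart n A)

theorem upperFactor_mul_lowerFactor {A : Mat n} (hA : A ∈ (gaussChart n).source) :
    upperFactor A * lowerFactor A = A := by
  rw [upperFactor, lowerFactor, ← gaussChart_symm, (gaussChart n).left_inv hA]

theorem isTriangularPair_factors (A : Mat n) : IsTriangularPair (upperFactor A) (lowerFactor A) :=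
  isTriangularPair_r _

theorem contDiffAt_gaussChart {A : Mat n} (hA : A ∈ (gaussChart n).source) :
    ContDiffAt ℝ ∞ (gaussChart n) A :=
  contDiffOn_gaussChart.contDiffAt ((gaussChart n).open_source.mem_nhds hA)

theorem contDiffAt_upperFactor {A : Mat n} (hA : A ∈ (gaussChart n).source) :
    ContDiffAt ℝ ∞ upperFactor A :=
  contDiffAt_const.add (rPlusCLM.contDiff.contDiffAt.comp A (contDiffAt_gaussChart hA))

theorem contDiffAt_lowerFactor {A : Mat n} (hA : A ∈ (gaussChart n).source) :
    ContDiffAt ℝ ∞ lowerFactor A :=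
  contDiffAt_const.sub (rMinusCLM.contDiff.contDiffAt.comp A (contDiffAt_gaussChart hA))

theorem exists_factors {A : Mat n} (hA : A ∈ (gaussChart n).source) (hu : IsUnit A) :
    ∃ B C : GL (Fin n) ℂ, (B : Mat n) = upperFactor A ∧ (C : Mat n) = lowerFactor A ∧
      ((B * C : GL (Fin n) ℂ) : Mat n) = A := by
  have h := upperFactor_mul_lowerFactor hA
  have hB : IsUnit (upperFactor A) := by
    rw [Matrix.isUnit_iff_isUnit_det] at hu ⊢
    rw [← h, Matrix.det_mul] at hu
    exact isUnit_of_mul_isUnit_left hu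
  have hC : IsUnit (lowerFactor A) := by
    rw [Matrix.isUnit_iff_isUnit_det] at hu ⊢
    rw [← h, Matrix.det_mul] at hu
    exact isUnit_of_mul_isUnit_right hu
  exact ⟨hB.unit, hC.unit, rfl, rfl, h⟩

theorem isUnit_upperFactor {A : Mat n} (hA : A ∈ (gaussChart n).source) (hu : IsUnit A) :
    IsUnit (upperFactor A) := by
  obtain ⟨B, _, hB, _⟩ := exists_factors hA hu
  exact hB ▸ B.isUnit

theorem isUnit_lowerFactor {A : Mat n} (hA : A ∈ (gaussChart n).source) (hu : IsUnit A) :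
    IsUnit (lowerFactor A) := by
  obtain ⟨_, C, _, hC, _⟩ := exists_factors hA hu
  exact hC ▸ C.isUnit

/-- Invertible matrices `A = b c` near the identity for which the triangular pair `(b⁻¹, c⁻¹)` is
also close enough to `(1, 1)` to be recovered from the product `b⁻¹ c⁻¹`. -/
def gaussDomain (n : ℕ) : Set (Mat n) :=
  {A | A ∈ (gaussChart n).source ∧ IsUnit A} ∩
    (fun A => Ring.inverse (upperFactor A) + Ring.inverse (lowerFactor A) - 2) ⁻¹'
      (gaussChart n).target

theorem isOpen_gaussDomain : IsOpen (gaussDomain n) := by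
  have ho : IsOpen {A : Mat n | A ∈ (gaussChart n).source ∧ IsUnit A} :=
    (gaussChart n).open_source.inter Units.isOpen
  refine ContinuousOn.isOpen_inter_preimage (fun A hA => ?_) ho (gaussChart n).open_target
  refine ContinuousAt.continuousWithinAt ?_
  have h1 : ContinuousAt (fun A : Mat n => Ring.inverse (upperFactor A)) A := by
    obtain ⟨u, hu⟩ := isUnit_upperFactor hA.1 hA.2
    refine ContinuousAt.comp (g := Ring.inverse) ?_ (contDiffAt_upperFactor hA.1).continuousAt
    rw [← hu]
    exact NormedRing.inverse_continuousAt u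
  have h2 : ContinuousAt (fun A : Mat n => Ring.inverse (lowerFactor A)) A := by
    obtain ⟨u, hu⟩ := isUnit_lowerFactor hA.1 hA.2
    refine ContinuousAt.comp (g := Ring.inverse) ?_ (contDiffAt_lowerFactor hA.1).continuousAt
    rw [← hu]
    exact NormedRing.inverse_continuousAt u
  exact (h1.add h2).sub continuousAt_const

theorem rPlus_zero : rPlus (0 : Mat n) = 0 := map_zero rPlusCLM

theorem rMinus_zero : rMinus (0 : Mat n) = 0 := map_zero rMinusCLM

theorem upperFactor_one : upperFactor (1 : Mat n) = 1 := by
  rw [upperFactor, gaussChart_one, rPlus_zero, add_zero]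

theorem lowerFactor_one : lowerFactor (1 : Mat n) = 1 := by
  rw [lowerFactor, gaussChart_one, rMinus_zero, sub_zero]

theorem one_mem_gaussDomain : 1 ∈ gaussDomain n := by
  refine ⟨⟨one_mem_gaussChart_source, isUnit_one⟩, ?_⟩
  rw [Set.mem_preimage, upperFactor_one, lowerFactor_one, Ring.inverse_one, one_add_one_eq_two,
    sub_self, ← gaussChart_one]
  exact (gaussChart n).map_source one_mem_gaussChart_source

/-- If `A = b c` lies in the domain then so does `b⁻¹ c⁻¹`, and its factors are `b⁻¹` and `c⁻¹`. -/
theorem gaussDomain_factors {A : Mat n} (hA : A ∈ gaussDomain n) : ∃ B C : GL (Fin n) ℂ,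
    (B : Mat n) = upperFactor A ∧ (C : Mat n) = lowerFactor A ∧
    ((B * C : GL (Fin n) ℂ) : Mat n) = A ∧
    ((B⁻¹ * C⁻¹ : GL (Fin n) ℂ) : Mat n) ∈ gaussDomain n ∧
    upperFactor ((B⁻¹ * C⁻¹ : GL (Fin n) ℂ) : Mat n) = ((B⁻¹ : GL (Fin n) ℂ) : Mat n) := by
  obtain ⟨B, C, hB, hC, hBC⟩ := exists_factors hA.1.1 hA.1.2
  have hp : IsTriangularPair (B : Mat n) C := by rw [hB, hC]; exact isTriangularPair_factors A
  obtain ⟨hi1, hi2⟩ := hp.inv.r_eq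
  have ht : ((B⁻¹ : GL (Fin n) ℂ) : Mat n) + ((C⁻¹ : GL (Fin n) ℂ) : Mat n) - 2
      ∈ (gaussChart n).target := by
    have h := hA.2
    rw [Set.mem_preimage, ← hB, ← hC, Ring.inverse_unit, Ring.inverse_unit] at h
    exact h
  set X := ((B⁻¹ : GL (Fin n) ℂ) : Mat n) + ((C⁻¹ : GL (Fin n) ℂ) : Mat n) - 2 with hX
  have hs : (gaussChart n).symm X = ((B⁻¹ * C⁻¹ : GL (Fin n) ℂ) : Mat n) := by
    rw [gaussChart_symm, hi1, hi2, Units.val_mul]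
  have hX2 : gaussChart n ((B⁻¹ * C⁻¹ : GL (Fin n) ℂ) : Mat n) = X := by
    rw [← hs, (gaussChart n).right_inv ht]
  have hu : upperFactor ((B⁻¹ * C⁻¹ : GL (Fin n) ℂ) : Mat n) = ((B⁻¹ : GL (Fin n) ℂ) : Mat n) := by
    rw [upperFactor, hX2, hi1]
  have hl : lowerFactor ((B⁻¹ * C⁻¹ : GL (Fin n) ℂ) : Mat n) = ((C⁻¹ : GL (Fin n) ℂ) : Mat n) := by
    rw [lowerFactor, hX2, hi2]
  refine ⟨B, C, hB, hC, hBC, ⟨⟨?_, Units.isUnit _⟩, ?_⟩, hu⟩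
  · rw [← hs]; exact (gaussChart n).map_target ht
  · rw [Set.mem_preimage, hu, hl, Ring.inverse_unit, Ring.inverse_unit, inv_inv, inv_inv, hB, hC]
    have h := (gaussChart n).map_source hA.1.1
    convert h using 1
    have h2 := rPlus_sub_rMinus (gaussChart n A)
    rw [upperFactor, lowerFactor, ← one_add_one_eq_two]
    nth_rw 3 [← h2]
    abel

/-! ### The map between the Heisenberg double and `M` -/

/-- The map `(g₁, g₂) ↦ (g₁⁻¹ b, g₁⁻¹ g₂)`, where `b` is the upper triangular factor of
`g₁ g₂⁻¹`. -/
def doubleMap (y : GL (Fin n) ℂ × GL (Fin n) ℂ) : M n :=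
  (y.1⁻¹ * toGL (upperFactor ((y.1 * y.2⁻¹ : GL (Fin n) ℂ) : Mat n)),
    ((y.1⁻¹ * y.2 : GL (Fin n) ℂ) : Mat n))

/-- The inverse map `(g, J) ↦ (b⁻¹ g⁻¹, b⁻¹ g⁻¹ J)`, where `b` is the upper triangular factor of
`g⁻¹ J g`. -/
def doubleMapInv (x : M n) : GL (Fin n) ℂ × GL (Fin n) ℂ :=
  ((toGL (upperFactor (((x.1⁻¹ : GL (Fin n) ℂ) : Mat n) * x.2 * (x.1 : Mat n))))⁻¹ * x.1⁻¹,
    (toGL (upperFactor (((x.1⁻¹ : GL (Fin n) ℂ) : Mat n) * x.2 * (x.1 : Mat n))))⁻¹ * x.1⁻¹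
      * toGL x.2)

/-- The domain of `doubleMap`. The condition on `g₁⁻¹ g₂` ensures that `J` has a triangular
factorization. -/
def doubleSource (n : ℕ) : Set (GL (Fin n) ℂ × GL (Fin n) ℂ) :=
  {y | ((y.1 * y.2⁻¹ : GL (Fin n) ℂ) : Mat n) ∈ gaussDomain n ∧
    ((y.1⁻¹ * y.2 : GL (Fin n) ℂ) : Mat n) ∈ (gaussChart n).source}

/-- The range of `doubleMap`. -/
def doubleTarget (n : ℕ) : Set (M n) :=
  {x | ((x.1⁻¹ : GL (Fin n) ℂ) : Mat n) * x.2 * (x.1 : Mat n) ∈ gaussDomain n ∧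
    x.2 ∈ (gaussChart n).source}

theorem doubleMap_spec {y : GL (Fin n) ℂ × GL (Fin n) ℂ} (hy : y ∈ doubleSource n) :
    doubleMap y ∈ doubleTarget n ∧ doubleMapInv (doubleMap y) = y := by
  obtain ⟨B, C, hB, hC, hBC, hd, hu⟩ := gaussDomain_factors hy.1
  have hBC' : B * C = y.1 * y.2⁻¹ := Units.ext hBC
  have h1 : doubleMap y = (y.1⁻¹ * B, ((y.1⁻¹ * y.2 : GL (Fin n) ℂ) : Mat n)) := by
    rw [doubleMap, ← hB, toGL_coe]
  have h2 : (((y.1⁻¹ * B)⁻¹ : GL (Fin n) ℂ) : Mat n) * ((y.1⁻¹ * y.2 : GL (Fin n) ℂ) : Mat n)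
      * ((y.1⁻¹ * B : GL (Fin n) ℂ) : Mat n) = ((B⁻¹ * C⁻¹ : GL (Fin n) ℂ) : Mat n) := by
    have h3 : y.2 * y.1⁻¹ = C⁻¹ * B⁻¹ := by
      rw [← mul_inv_rev, hBC', mul_inv_rev, inv_inv]
    rw [← Units.val_mul, ← Units.val_mul]
    congr 1
    calc (y.1⁻¹ * B)⁻¹ * (y.1⁻¹ * y.2) * (y.1⁻¹ * B) = B⁻¹ * (y.2 * y.1⁻¹) * B := by group
      _ = B⁻¹ * C⁻¹ := by rw [h3]; group
  rw [h1]
  refine ⟨⟨?_, hy.2⟩, ?_⟩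
  · simp only [h2]; exact hd
  · simp only [doubleMapInv, h2, hu, toGL_coe]
    refine Prod.ext ?_ ?_ <;> simp only <;> group

theorem doubleMapInv_spec {x : M n} (hx : x ∈ doubleTarget n) :
    doubleMapInv x ∈ doubleSource n ∧ doubleMap (doubleMapInv x) = x := by
  obtain ⟨B, C, hB, hC, hBC, hd, hu⟩ := gaussDomain_factors hx.1
  obtain ⟨g, J⟩ := x
  simp only at hB hC hBC hd hu
  have hJ : J = ((g * (B * C) * g⁻¹ : GL (Fin n) ℂ) : Mat n) := by
    rw [Units.val_mul, Units.val_mul, hBC]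
    simp [← mul_assoc]
  have h1 : doubleMapInv (g, J) = (B⁻¹ * g⁻¹, C * g⁻¹) := by
    simp only [doubleMapInv, ← hB, toGL_coe]
    rw [hJ, toGL_coe]
    refine Prod.ext ?_ ?_ <;> simp only
    group
  have h2 : B⁻¹ * g⁻¹ * (C * g⁻¹)⁻¹ = B⁻¹ * C⁻¹ := by group
  have h3 : (((B⁻¹ * g⁻¹)⁻¹ * (C * g⁻¹) : GL (Fin n) ℂ) : Mat n) = J := by
    rw [hJ]; congr 1; group
  rw [h1]
  refine ⟨⟨?_, ?_⟩, ?_⟩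
  · simp only [h2]; exact hd
  · simp only [h3]; exact hx.2
  · simp only [doubleMap, h2, h3, hu, toGL_coe]
    refine Prod.ext ?_ rfl
    simp only
    group

/-- The model space of `GL(n,ℂ) × GL(n,ℂ)` as a real manifold. -/
abbrev IG (n : ℕ) := (𝓘(ℝ, Mat n)).prod 𝓘(ℝ, Mat n)

theorem contMDiffAt_toGL_comp {M' H' E' : Type*} [NormedAddCommGroup E'] [NormedSpace ℝ E']
    [TopologicalSpace H'] {I : ModelWithCorners ℝ E' H'} [TopologicalSpace M'] [ChartedSpace H' M']
    {a : M' → Mat n} {y : M'} (ha : ContMDiffAt I 𝓘(ℝ, Mat n) ∞ a y) (hu : IsUnit (a y)) :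
    ContMDiffAt I 𝓘(ℝ, Mat n) ∞ (fun z => toGL (a z)) y := by
  refine ContMDiffAt.comp y (g := toGL) ?_ ha
  obtain ⟨u, hu⟩ := hu
  rw [← hu]
  exact contMDiffAt_toGL u

theorem contMDiffAt_upperFactor_comp {M' H' E' : Type*} [NormedAddCommGroup E'] [NormedSpace ℝ E']
    [TopologicalSpace H'] {I : ModelWithCorners ℝ E' H'} [TopologicalSpace M'] [ChartedSpace H' M']
    {a : M' → Mat n} {y : M'} (ha : ContMDiffAt I 𝓘(ℝ, Mat n) ∞ a y)
    (hs : a y ∈ (gaussChart n).source) (hu : IsUnit (a y)) :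
    ContMDiffAt I 𝓘(ℝ, Mat n) ∞ (fun z => toGL (upperFactor (a z))) y :=
  contMDiffAt_toGL_comp
    ((contMDiffAt_iff_contDiffAt.2 (contDiffAt_upperFactor hs)).comp y ha)
    (isUnit_upperFactor hs hu)

theorem contMDiff_coe_mul_inv : ContMDiff (IG n) 𝓘(ℝ, Mat n) ∞
    fun y : GL (Fin n) ℂ × GL (Fin n) ℂ => ((y.1 * y.2⁻¹ : GL (Fin n) ℂ) : Mat n) :=
  Units.contMDiff_val.comp (contMDiff_fst.mul contMDiff_snd.inv)

theorem contMDiff_coe_inv_mul : ContMDiff (IG n) 𝓘(ℝ, Mat n) ∞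
    fun y : GL (Fin n) ℂ × GL (Fin n) ℂ => ((y.1⁻¹ * y.2 : GL (Fin n) ℂ) : Mat n) :=
  Units.contMDiff_val.comp (contMDiff_fst.inv.mul contMDiff_snd)

theorem contMDiff_conj : ContMDiff (IM n) 𝓘(ℝ, Mat n) ∞
    fun x : M n => ((x.1⁻¹ : GL (Fin n) ℂ) : Mat n) * x.2 * (x.1 : Mat n) :=
  contMDiff_mul_matrix (contMDiff_mul_matrix contMDiff_coe_inv_fst contMDiff_snd) contMDiff_coe_fst

theorem contMDiffOn_doubleMap : ContMDiffOn (IG n) (IM n) ∞ (doubleMap (n := n))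
    (doubleSource n) := fun y hy => by
  refine ContMDiffAt.contMDiffWithinAt ?_
  refine ContMDiffAt.prodMk ?_ contMDiff_coe_inv_mul.contMDiffAt
  exact ContMDiffAt.mul contMDiff_fst.inv.contMDiffAt
    (contMDiffAt_upperFactor_comp contMDiff_coe_mul_inv.contMDiffAt hy.1.1.1 hy.1.1.2)

theorem contMDiffOn_doubleMapInv : ContMDiffOn (IM n) (IG n) ∞ (doubleMapInv (n := n))
    (doubleTarget n) := fun x hx => by
  have hJ : IsUnit x.2 := by
    have h := hx.1.1.2
    have h2 := (x.1.isUnit.mul h).mul x.1⁻¹.isUnit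
    simpa [← mul_assoc] using h2
  refine ContMDiffAt.contMDiffWithinAt ?_
  have h1 : ContMDiffAt (IM n) 𝓘(ℝ, Mat n) ∞ (fun x : M n =>
      (toGL (upperFactor (((x.1⁻¹ : GL (Fin n) ℂ) : Mat n) * x.2 * (x.1 : Mat n))))⁻¹ * x.1⁻¹) x :=
    ContMDiffAt.mul (contMDiffAt_upperFactor_comp contMDiff_conj.contMDiffAt hx.1.1.1 hx.1.1.2).inv
      contMDiff_fst.inv.contMDiffAt
  exact h1.prodMk (h1.mul (contMDiffAt_toGL_comp contMDiff_snd.contMDiffAt hJ))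

theorem isOpen_doubleSource : IsOpen (doubleSource n) :=
  (isOpen_gaussDomain.preimage contMDiff_coe_mul_inv.continuous).inter
    ((gaussChart n).open_source.preimage contMDiff_coe_inv_mul.continuous)

theorem isOpen_doubleTarget : IsOpen (doubleTarget n) :=
  (isOpen_gaussDomain.preimage contMDiff_conj.continuous).inter
    ((gaussChart n).open_source.preimage continuous_snd)

/-- The local diffeomorphism from the Heisenberg double to `M`. -/
def doubleHomeo (n : ℕ) : OpenPartialHomeomorph (GL (Fin n) ℂ × GL (Fin n) ℂ) (M n) where
  toFun := doubleMap
  invFun := doubleMapInv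
  source := doubleSource n
  target := doubleTarget n
  map_source' _ hy := (doubleMap_spec hy).1
  map_target' _ hx := (doubleMapInv_spec hx).1
  left_inv' _ hy := (doubleMap_spec hy).2
  right_inv' _ hx := (doubleMapInv_spec hx).2
  open_source := isOpen_doubleSource
  open_target := isOpen_doubleTarget
  continuousOn_toFun := contMDiffOn_doubleMap.continuousOn
  continuousOn_invFun := contMDiffOn_doubleMapInv.continuousOn

theorem one_mem_doubleSource : ((1, 1) : GL (Fin n) ℂ × GL (Fin n) ℂ) ∈ doubleSource n := by
  refine ⟨?_, ?_⟩
  · simpa using one_mem_gaussDomain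
  · simpa using one_mem_gaussChart_source

theorem doubleMap_one : doubleMap ((1, 1) : GL (Fin n) ℂ × GL (Fin n) ℂ) = (1, 1) := by
  have h : toGL (1 : Mat n) = 1 := toGL_coe 1
  simp [doubleMap, upperFactor_one, h]

/-- The factors `η_{*R}`, `η_{*L}` come from the triangular factorizations of `g₁⁻¹ g₂` and of
`g₁ g₂⁻¹`, respectively. -/
theorem factorRel_doubleMap {y : GL (Fin n) ℂ × GL (Fin n) ℂ} (hy : y ∈ doubleSource n) :
    FactorRel y (doubleMap y) := by
  obtain ⟨B', C', hB', hC', hBC'⟩ := exists_factors hy.1.1.1 hy.1.1.2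
  obtain ⟨B, C, hB, hC, hBC⟩ := exists_factors hy.2 (Units.isUnit _)
  have hp' : IsTriangularPair (B' : Mat n) C' := by
    rw [hB', hC']; exact isTriangularPair_factors _
  have hp : IsTriangularPair (B : Mat n) C := by
    rw [hB, hC]; exact isTriangularPair_factors _
  obtain ⟨u', d', l', ht', hb', hc'⟩ := hp'.exists_triple
  obtain ⟨u, d, l, ht, hb, hc⟩ := hp.exists_triple
  replace hBC := Units.ext hBC
  replace hBC' := Units.ext hBC'
  refine ⟨y.1 * B, u, d, l, u', d', l', ht, ht', ?_, ?_, ?_⟩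
  · refine Prod.ext ?_ ?_
    · simp only [dualElt, Prod.fst_mul, Prod.fst_inv, ← hb]; group
    · simp only [dualElt, Prod.snd_mul, Prod.snd_inv, ← hc, inv_inv, mul_assoc, hBC]; group
  · have h1 : (doubleMap y).1 = y.1⁻¹ * B' := by rw [doubleMap, ← hB', toGL_coe]
    refine Prod.ext ?_ ?_
    · simp only [dualElt, Prod.fst_mul, Prod.fst_inv, h1, ← hb']; group
    · simp only [dualElt, Prod.snd_mul, Prod.snd_inv, h1, ← hc']
      calc y.2 = (y.1 * y.2⁻¹)⁻¹ * y.1 := by group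
        _ = C'⁻¹ * (y.1⁻¹ * B')⁻¹ := by rw [← hBC']; group
  · rw [doubleMap, ← hBC, hb, hc]
    simp only [mul_assoc]

/-! ### Derivatives of functions pulled back to the Heisenberg double -/

theorem gradientWrt_pairing2_eq {φ : Mat n × Mat n → ℝ} {Y : Mat n × Mat n}
    (h : ∀ X, pairing2 Y X = φ X) : gradientWrt pairing2 φ = Y := by
  have h1 : ∀ X, pairing2 (gradientWrt pairing2 φ) X = pairing2 Y X := fun X => by
    rw [gradientWrt_spec ⟨Y, h⟩, h]
  refine Prod.ext (pairing_left_injective fun X => ?_) (pairing_left_injective fun X => ?_)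
  · have h2 := h1 (X, 0)
    simpa [pairing2, pairing] using h2
  · have h2 := h1 (0, X)
    simpa [pairing2, pairing] using h2

/-- The derivative of the upper triangular factor `b` along a curve `A(t)`: if `c` is the lower
triangular factor, then `b⁻¹ b' + c' c⁻¹ = b⁻¹ A' c⁻¹`, and `b⁻¹ b'` is the `r₊`-part of the
right-hand side. -/
theorem hasDerivAt_upperFactor {A : ℝ → Mat n} {A' : Mat n} (hA : HasDerivAt A A' 0)
    (hs : A 0 ∈ (gaussChart n).source) {B C : GL (Fin n) ℂ} (hB : (B : Mat n) = upperFactor (A 0))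
    (hC : (C : Mat n) = lowerFactor (A 0)) :
    HasDerivAt (fun t => upperFactor (A t)) ((B : Mat n) * rPlus
      (((B⁻¹ : GL (Fin n) ℂ) : Mat n) * A' * ((C⁻¹ : GL (Fin n) ℂ) : Mat n))) 0 := by
  have hg := ((contDiffAt_gaussChart hs).differentiableAt (by simp)).hasFDerivAt.comp_hasDerivAt
    (0 : ℝ) hA
  set X' := fderiv ℝ (gaussChart n) (A 0) A'
  have hb : HasDerivAt (fun t => upperFactor (A t)) (rPlus X') 0 :=
    (rPlusCLM.hasFDerivAt.comp_hasDerivAt (0 : ℝ) hg).const_add 1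
  have hc : HasDerivAt (fun t => lowerFactor (A t)) (-rMinus X') 0 :=
    (rMinusCLM.hasFDerivAt.comp_hasDerivAt (0 : ℝ) hg).const_sub 1
  have hprod : A' = rPlus X' * C + (B : Mat n) * -rMinus X' := by
    have h1 := hb.mul hc
    rw [← hB, ← hC] at h1
    refine hA.unique (h1.congr_of_eventuallyEq ?_)
    filter_upwards [hA.continuousAt.eventually ((gaussChart n).open_source.mem_nhds hs)] with t ht
    exact (upperFactor_mul_lowerFactor ht).symm
  have hp : IsTriangularPair (B : Mat n) C := by
    rw [hB, hC]; exact isTriangularPair_factors _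
  have hX := isTriangularPair_r X'
  have hU : (rPlus X').BlockTriangular id := by
    simpa using hX.upper.sub Matrix.blockTriangular_one
  have hL : (rMinus X').BlockTriangular OrderDual.toDual := by
    have h := (Matrix.blockTriangular_one (R := ℂ) (b := OrderDual.toDual (α := Fin n))).sub
      hX.lower
    rwa [sub_sub_cancel] at h
  have hd : ∀ i, rPlus X' i i = -rMinus X' i i := fun i => by
    have h := hX.diag i
    rw [Matrix.add_apply, Matrix.sub_apply, sub_eq_add_neg] at h
    exact add_left_cancel h
  have hsplit : ((B⁻¹ : GL (Fin n) ℂ) : Mat n) * A' * ((C⁻¹ : GL (Fin n) ℂ) : Mat n)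
      = ((B⁻¹ : GL (Fin n) ℂ) : Mat n) * rPlus X'
        - rMinus X' * ((C⁻¹ : GL (Fin n) ℂ) : Mat n) := by
    rw [hprod, mul_add, add_mul]
    simp [mul_assoc, ← sub_eq_add_neg]
  rw [hsplit, rPlus_sub_of_triangular ((blockTriangular_coe_inv hp.upper).mul hU)
    (hL.mul (blockTriangular_coe_inv hp.lower))]
  · simpa using hb
  · intro i
    rw [upper_mul_diag (blockTriangular_coe_inv hp.upper) hU,
      lower_mul_diag hL (blockTriangular_coe_inv hp.lower), hp.inv_diag, hd]
    ring

section Transfer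

variable {y : GL (Fin n) ℂ × GL (Fin n) ℂ}

/-- The derivative of `doubleMap` along the left translations. -/
theorem hasDerivAt_doubleMap (hy : y ∈ doubleSource n) {B C : GL (Fin n) ℂ}
    (hB : (B : Mat n) = upperFactor ((y.1 * y.2⁻¹ : GL (Fin n) ℂ) : Mat n))
    (hC : (C : Mat n) = lowerFactor ((y.1 * y.2⁻¹ : GL (Fin n) ℂ) : Mat n)) (X : Mat n × Mat n) :
    HasDerivAt (fun t : ℝ => emb (doubleMap (expGL (t • X.1) * y.1, expGL (t • X.2) * y.2)))
      (((y.1⁻¹ * B : GL (Fin n) ℂ) : Mat n) *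
        (rPlus (((B⁻¹ : GL (Fin n) ℂ) : Mat n) * X.1 * (B : Mat n)
            - (C : Mat n) * X.2 * ((C⁻¹ : GL (Fin n) ℂ) : Mat n))
          - ((B⁻¹ : GL (Fin n) ℂ) : Mat n) * X.1 * (B : Mat n)),
        ((y.1⁻¹ : GL (Fin n) ℂ) : Mat n) * (X.2 - X.1) * (y.2 : Mat n)) 0 := by
  obtain ⟨g1, g2⟩ := y
  obtain ⟨X1, X2⟩ := X
  simp only at hB hC ⊢
  have hBC : g1 * g2⁻¹ = B * C := Units.ext (by
    rw [Units.val_mul B, hB, hC, upperFactor_mul_lowerFactor hy.1.1.1])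
  have e1 := hasDerivAt_expGL X1
  have e1' := hasDerivAt_expGL (-X1)
  have e2 := hasDerivAt_expGL X2
  have e2' := hasDerivAt_expGL (-X2)
  have hA : HasDerivAt (fun t : ℝ => (((expGL (t • X1) * g1) * (expGL (t • X2) * g2)⁻¹ :
      GL (Fin n) ℂ) : Mat n)) (X1 * (g1 * g2⁻¹ : GL (Fin n) ℂ)
        - ((g1 * g2⁻¹ : GL (Fin n) ℂ) : Mat n) * X2) 0 := by
    have h := (e1.mul_const ((g1 * g2⁻¹ : GL (Fin n) ℂ) : Mat n)).mul e2'
    convert! h using 1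
    · funext t
      simp only [Pi.mul_apply, mul_inv_rev, Units.val_mul, coe_expGL_inv, mul_assoc]
    · simp [expGL_zero, sub_eq_add_neg]
  have h0 : ((expGL ((0 : ℝ) • X1) * g1) * (expGL ((0 : ℝ) • X2) * g2)⁻¹ : GL (Fin n) ℂ)
      = g1 * g2⁻¹ := by simp [expGL_zero]
  have hs0 : ∀ᶠ t : ℝ in nhds 0, (((expGL (t • X1) * g1) * (expGL (t • X2) * g2)⁻¹ :
      GL (Fin n) ℂ) : Mat n) ∈ (gaussChart n).source := by
    refine hA.continuousAt.eventually ((gaussChart n).open_source.mem_nhds ?_)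
    simp only [h0]; exact hy.1.1.1
  have hb := hasDerivAt_upperFactor hA (by rw [h0]; exact hy.1.1.1) (B := B) (C := C)
    (by rw [h0]; exact hB) (by rw [h0]; exact hC)
  have hg : HasDerivAt (fun t : ℝ => ((doubleMap (expGL (t • X1) * g1, expGL (t • X2) * g2)).1 :
      Mat n)) _ 0 :=
    ((e1'.const_mul ((g1⁻¹ : GL (Fin n) ℂ) : Mat n)).mul hb).congr_of_eventuallyEq (by
      filter_upwards [hs0] with t ht
      rw [doubleMap, Units.val_mul, coe_toGL (isUnit_upperFactor ht (Units.isUnit _)), mul_inv_rev,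
        Units.val_mul, coe_expGL_inv]
      rfl)
  have hJ : HasDerivAt (fun t : ℝ => (doubleMap (expGL (t • X1) * g1, expGL (t • X2) * g2)).2)
      _ 0 :=
    (((e1'.const_mul ((g1⁻¹ : GL (Fin n) ℂ) : Mat n)).mul e2).mul_const
      (g2 : Mat n)).congr_of_eventuallyEq
      (Filter.Eventually.of_forall fun t => by
        simp only [doubleMap, Pi.mul_apply, mul_inv_rev, Units.val_mul, coe_expGL_inv, mul_assoc])
  refine (hg.prodMk hJ).congr_deriv (Prod.ext ?_ ?_)
  · rw [h0, ← hB, hBC]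
    simp only [Units.val_mul, zero_smul, expGL_zero, Units.val_one, mul_one, mul_neg, neg_mul,
      mul_sub, sub_mul, mul_assoc, Units.mul_inv, Units.inv_mul_cancel_left,
      Units.mul_inv_cancel_left]
    abel
  · simp [expGL_zero, mul_sub, sub_mul, mul_assoc, add_mul]
    abel

variable {F : M n → ℝ}

/-- The left derivative of a pulled back function, in terms of the derivatives of the function. -/
theorem pairing2_leftDeriv (hy : y ∈ doubleSource n)
    (hF : DifferentiableAt ℝ (coordFn F) (emb (doubleMap y))) {B C : GL (Fin n) ℂ}
    (hB : (B : Mat n) = upperFactor ((y.1 * y.2⁻¹ : GL (Fin n) ℂ) : Mat n))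
    (hC : (C : Mat n) = lowerFactor ((y.1 * y.2⁻¹ : GL (Fin n) ℂ) : Mat n)) (X : Mat n × Mat n) :
    pairing2 (-((B : Mat n) * rPlus (nabla1' F (doubleMap y)) * ((B⁻¹ : GL (Fin n) ℂ) : Mat n))
        - (y.2 : Mat n) * d2 F (doubleMap y) * ((y.1⁻¹ : GL (Fin n) ℂ) : Mat n),
      -(((C⁻¹ : GL (Fin n) ℂ) : Mat n) * rMinus (nabla1' F (doubleMap y)) * (C : Mat n))
        - (y.2 : Mat n) * d2 F (doubleMap y) * ((y.1⁻¹ : GL (Fin n) ℂ) : Mat n)) X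
    = deriv (fun t : ℝ => (F ∘ doubleMap) (expGL (t • X.1) * y.1, expGL (t • X.2) * y.2)) 0 := by
  have h := hasDerivAt_comp_curve (F := F) (x := doubleMap y)
    (γ := fun t : ℝ => doubleMap (expGL (t • X.1) * y.1, expGL (t • X.2) * y.2)) hF
    (by simp [expGL_zero]) (hasDerivAt_doubleMap hy hB hC X)
  rw [show (fun t : ℝ => (F ∘ doubleMap) (expGL (t • X.1) * y.1, expGL (t • X.2) * y.2))
    = fun t : ℝ => F (doubleMap (expGL (t • X.1) * y.1, expGL (t • X.2) * y.2)) from rfl, h.deriv,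
    cot_apply, nabla1'_eq hF, d2_eq hF]
  have hg : (doubleMap y).1 = y.1⁻¹ * B := by rw [doubleMap, ← hB, toGL_coe]
  rw [hg]
  generalize gradG (fderiv ℝ (coordFn F) (emb (doubleMap y))) = a
  generalize gradJ (fderiv ℝ (coordFn F) (emb (doubleMap y))) = D
  rw [← pairing_mul_left a]
  generalize a * ((y.1⁻¹ * B : GL (Fin n) ℂ) : Mat n) = P
  have h1 : ∀ Z, pairing P (rPlus Z) = -pairing (rMinus P) Z := fun Z => by
    rw [rPlus, rMinus, pairing_add_right, pairing_sub_left, pairing_r_left, pairing_smul_left,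
      pairing_smul_right]; ring
  have h2 : ∀ Q : Mat n, pairing Q (((B⁻¹ : GL (Fin n) ℂ) : Mat n) * X.1 * (B : Mat n))
      = pairing ((B : Mat n) * Q * ((B⁻¹ : GL (Fin n) ℂ) : Mat n)) X.1 := fun Q => by
    rw [pairing_mul_left, pairing_mul_cyclic, mul_assoc]
  have h3 : ∀ Q : Mat n, pairing Q ((C : Mat n) * X.2 * ((C⁻¹ : GL (Fin n) ℂ) : Mat n))
      = pairing (((C⁻¹ : GL (Fin n) ℂ) : Mat n) * Q * (C : Mat n)) X.2 := fun Q => by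
    rw [pairing_mul_left, pairing_mul_cyclic, mul_assoc]
  have h4 : ∀ Z : Mat n, pairing D (((y.1⁻¹ : GL (Fin n) ℂ) : Mat n) * Z * (y.2 : Mat n))
      = pairing ((y.2 : Mat n) * D * ((y.1⁻¹ : GL (Fin n) ℂ) : Mat n)) Z := fun Z => by
    rw [pairing_mul_left, pairing_mul_cyclic, mul_assoc]
  have h5 : rPlus P = rMinus P + P := sub_eq_iff_eq_add'.1 (rPlus_sub_rMinus P)
  simp only [pairing2, pairing_sub_right, h1, h2, h3, h4, h5, pairing_sub_left, pairing_neg_left,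
    mul_add, add_mul, pairing_add_left]
  ring

theorem mul_expGL (g : GL (Fin n) ℂ) (X : Mat n) (t : ℝ) :
    g * expGL (t • X) = expGL (t • ((g : Mat n) * X * ((g⁻¹ : GL (Fin n) ℂ) : Mat n))) * g := by
  refine Units.ext ?_
  rw [Units.val_mul, Units.val_mul, coe_expGL, coe_expGL, ← smul_mul_assoc, ← mul_smul_comm]
  rw [Matrix.exp_units_conj]
  simp [mul_assoc]

/-- The right derivative of a differentiable function is conjugate to the left derivative. -/
theorem rightDeriv_eq {f : GL (Fin n) ℂ × GL (Fin n) ℂ → ℝ} {L : Mat n × Mat n}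
    (h : ∀ X, pairing2 L X = deriv (fun t : ℝ =>
      f (expGL (t • X.1) * y.1, expGL (t • X.2) * y.2)) 0) :
    rightDeriv f y = (((y.1⁻¹ : GL (Fin n) ℂ) : Mat n) * L.1 * (y.1 : Mat n),
      ((y.2⁻¹ : GL (Fin n) ℂ) : Mat n) * L.2 * (y.2 : Mat n)) := by
  refine gradientWrt_pairing2_eq fun X => ?_
  simp only [mul_expGL]
  rw [← h ((y.1 : Mat n) * X.1 * ((y.1⁻¹ : GL (Fin n) ℂ) : Mat n),
    (y.2 : Mat n) * X.2 * ((y.2⁻¹ : GL (Fin n) ℂ) : Mat n))]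
  simp only [pairing2]
  rw [mul_assoc, mul_assoc, pairing_mul_cyclic _ _ X.1, pairing_mul_cyclic _ _ X.2,
    pairing_mul_left, pairing_mul_left, mul_assoc, mul_assoc]

end Transfer

/-! ### Comparison of the second bracket with the Heisenberg double -/

/-- The form `⟨·, ρ ·⟩₂` in terms of the decomposition of its arguments: the diagonal and the dual
subspace are isotropic. -/
theorem pairing2_rho (Z W Z' W' : Mat n) :
    pairing2 (rPlus Z - W, rMinus Z - W) (rho (rPlus Z' - W', rMinus Z' - W'))
      = 1 / 2 * (pairing W Z' - pairing Z W') := by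
  have h : projDual (rPlus Z' - W', rMinus Z' - W') = (rPlus Z', rMinus Z') :=
    projDual_unique (Y := -W') (by simp [sub_eq_neg_add])
  have hZ : pairing Z W' = pairing (rPlus Z) W' - pairing (rMinus Z) W' := by
    rw [← pairing_sub_left, rPlus_sub_rMinus]
  have hZ' : pairing W Z' = pairing W (rPlus Z') - pairing W (rMinus Z') := by
    rw [← pairing_sub_right, rPlus_sub_rMinus]
  have hiso : pairing (rPlus Z) (rPlus Z') = pairing (rMinus Z) (rMinus Z') := by
    simp only [rPlus, rMinus, pairing_add_left, pairing_add_right, pairing_sub_left,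
      pairing_sub_right, pairing_smul_left, pairing_smul_right, pairing_r_left]
    ring
  rw [hZ, hZ', rho, projDiag, h]
  simp only [pairing2, Prod.smul_fst, Prod.smul_snd, Prod.fst_sub, Prod.snd_sub, pairing_smul_right,
    pairing_sub_right, pairing_sub_left]
  linarith

/-- The algebraic identity behind the comparison of the brackets. Here `p`, `q`, `q'` stand for
`∇₁F`, `∇₂F`, `∇₂'F`, while `N = g (r ∇₁'F) g⁻¹`, and similarly for the second function. -/
theorem bracket_identity {p q q' N P p₁ q₁ q₁' N₁ P₁ : Mat n}
    (hq : pairing q q₁ = pairing q' q₁') (hN : pairing N p₁ = pairing (r P) P₁)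
    (hN₁ : pairing N₁ p = pairing (r P₁) P) :
    1 / 2 * ((pairing (N + (1 / 2 : ℝ) • p) q₁ - pairing (N - (1 / 2 : ℝ) • p) q₁')
        - (pairing (N₁ + (1 / 2 : ℝ) • p₁) q - pairing (N₁ - (1 / 2 : ℝ) • p₁) q'))
      + 1 / 2 * (pairing (N + (1 / 2 : ℝ) • p + q - rPlus (p + q - q')) (-(p₁ + q₁ - q₁'))
        - pairing (-(p + q - q')) (N₁ + (1 / 2 : ℝ) • p₁ + q₁ - rPlus (p₁ + q₁ - q₁')))
    = pairing (r p) p₁ - pairing (r P) P₁ + pairing (q - q') (rPlus q₁' - rMinus q₁)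
      + pairing p (rPlus q₁' - rMinus q₁) - pairing p₁ (rPlus q' - rMinus q) := by
  simp only [rPlus, rMinus, r_add, r_sub, pairing_add_left, pairing_add_right, pairing_sub_left,
    pairing_sub_right, pairing_smul_left, pairing_smul_right, pairing_neg_left, pairing_neg_right,
    pairing_r_left, pairing_comm _ N₁] at *
  rw [pairing_r_swap P₁ P] at hN₁
  rw [pairing_r_swap p₁ q, pairing_r_swap p₁ q', pairing_comm p₁ q, pairing_comm p₁ q']
  linarith

section Compare

variable {y : GL (Fin n) ℂ × GL (Fin n) ℂ} {B C : GL (Fin n) ℂ}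

/-- Conjugating `r₊ P` by an upper triangular and `r₋ P` by a lower triangular matrix gives again
the components `r₊ Z`, `r₋ Z` of some `Z`. -/
theorem IsTriangularPair.r_conj (h : IsTriangularPair (B : Mat n) C) (P : Mat n) :
    rPlus ((B : Mat n) * rPlus P * ((B⁻¹ : GL (Fin n) ℂ) : Mat n)
        - ((C⁻¹ : GL (Fin n) ℂ) : Mat n) * rMinus P * (C : Mat n))
      = (B : Mat n) * rPlus P * ((B⁻¹ : GL (Fin n) ℂ) : Mat n) ∧
    rMinus ((B : Mat n) * rPlus P * ((B⁻¹ : GL (Fin n) ℂ) : Mat n)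
        - ((C⁻¹ : GL (Fin n) ℂ) : Mat n) * rMinus P * (C : Mat n))
      = ((C⁻¹ : GL (Fin n) ℂ) : Mat n) * rMinus P * (C : Mat n) := by
  have hP : (rPlus P).BlockTriangular id := by
    simpa using (isTriangularPair_r P).upper.sub Matrix.blockTriangular_one
  have hM : (rMinus P).BlockTriangular OrderDual.toDual := by
    have h1 := (Matrix.blockTriangular_one (R := ℂ) (b := OrderDual.toDual (α := Fin n))).sub
      (isTriangularPair_r P).lower
    rwa [sub_sub_cancel] at h1
  have hU := (h.upper.mul hP).mul (blockTriangular_coe_inv h.upper)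
  have hL := ((blockTriangular_coe_inv h.lower).mul hM).mul h.lower
  have hd : ∀ i, ((B : Mat n) * rPlus P * ((B⁻¹ : GL (Fin n) ℂ) : Mat n)) i i
      = -(((C⁻¹ : GL (Fin n) ℂ) : Mat n) * rMinus P * (C : Mat n)) i i := fun i => by
    have hB := upper_inv_diag h.upper i
    have hC := lower_inv_diag h.lower i
    have hr : rPlus P i i = -rMinus P i i := by simp [rPlus_apply, rMinus_apply]
    rw [upper_mul_diag (h.upper.mul hP) (blockTriangular_coe_inv h.upper),
      upper_mul_diag h.upper hP,
      lower_mul_diag ((blockTriangular_coe_inv h.lower).mul hM) h.lower,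
      lower_mul_diag (blockTriangular_coe_inv h.lower) hM]
    linear_combination rPlus P i i * hB + rMinus P i i * hC + hr
  exact ⟨rPlus_sub_of_triangular hU hL hd, rMinus_sub_of_triangular hU hL hd⟩

/-- The pairing of the dual component of one left derivative with the diagonal component of another,
moved to the point `(g, J)` of `M`, where `J = g₁⁻¹ g₂`. -/
theorem pairing_leftDeriv (hBC : y.1 * y.2⁻¹ = B * C) {g : GL (Fin n) ℂ} (hg : g = y.1⁻¹ * B)
    (P D : Mat n) :
    pairing ((B : Mat n) * rPlus P * ((B⁻¹ : GL (Fin n) ℂ) : Mat n)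
        - ((C⁻¹ : GL (Fin n) ℂ) : Mat n) * rMinus P * (C : Mat n))
        ((y.2 : Mat n) * D * ((y.1⁻¹ : GL (Fin n) ℂ) : Mat n))
      = pairing ((g : Mat n) * rPlus P * ((g⁻¹ : GL (Fin n) ℂ) : Mat n))
          (((y.1⁻¹ * y.2 : GL (Fin n) ℂ) : Mat n) * D)
        - pairing ((g : Mat n) * rMinus P * ((g⁻¹ : GL (Fin n) ℂ) : Mat n))
          (D * ((y.1⁻¹ * y.2 : GL (Fin n) ℂ) : Mat n)) := by
  have conj : ∀ (h k : GL (Fin n) ℂ) (R T : Mat n),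
      pairing ((h : Mat n) * R * ((h⁻¹ : GL (Fin n) ℂ) : Mat n)) T
        = pairing ((k : Mat n) * R * ((k⁻¹ : GL (Fin n) ℂ) : Mat n))
          (((k * h⁻¹ : GL (Fin n) ℂ) : Mat n) * T * ((h * k⁻¹ : GL (Fin n) ℂ) : Mat n)) := by
    intro h k R T
    rw [mul_assoc, mul_assoc, pairing_mul_cyclic, pairing_mul_left, pairing_mul_cyclic (k : Mat n),
      pairing_mul_left]
    simp [mul_assoc]
  have hC : C = g⁻¹ * y.2⁻¹ := by
    rw [hg]
    calc C = B⁻¹ * (B * C) := by group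
      _ = _ := by rw [← hBC]; group
  have h1 := conj B g (rPlus P) ((y.2 : Mat n) * D * ((y.1⁻¹ : GL (Fin n) ℂ) : Mat n))
  have h2 := conj C⁻¹ g (rMinus P) ((y.2 : Mat n) * D * ((y.1⁻¹ : GL (Fin n) ℂ) : Mat n))
  have e1 : g * B⁻¹ = y.1⁻¹ := by rw [hg]; group
  have e2 : B * g⁻¹ = y.1 := by rw [hg]; group
  have e3 : g * C = y.2⁻¹ := by rw [hC]; group
  have e4 : C⁻¹ * g⁻¹ = y.2 := by rw [hC]; group
  rw [inv_inv, e3, e4] at h2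
  rw [e1, e2] at h1
  rw [pairing_sub_left, h1, h2]
  simp [mul_assoc]

theorem rPlus_neg (X : Mat n) : rPlus (-X) = -rPlus X := map_neg rPlusCLM X

theorem rMinus_neg (X : Mat n) : rMinus (-X) = -rMinus X := map_neg rMinusCLM X

variable {F : M n → ℝ}

/-- The left derivative of a pulled back function, decomposed along the diagonal and the dual
subspace: the dual component is the one of `-V`, the diagonal component is `(-W, -W)`. -/
theorem leftDeriv_comp_doubleMap (hy : y ∈ doubleSource n)
    (hF : DifferentiableAt ℝ (coordFn F) (emb (doubleMap y)))
    (hB : (B : Mat n) = upperFactor ((y.1 * y.2⁻¹ : GL (Fin n) ℂ) : Mat n))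
    (hC : (C : Mat n) = lowerFactor ((y.1 * y.2⁻¹ : GL (Fin n) ℂ) : Mat n)) {V W : Mat n}
    (hV : V = (B : Mat n) * rPlus (nabla1' F (doubleMap y)) * ((B⁻¹ : GL (Fin n) ℂ) : Mat n)
        - ((C⁻¹ : GL (Fin n) ℂ) : Mat n) * rMinus (nabla1' F (doubleMap y)) * (C : Mat n))
    (hW : W = (y.2 : Mat n) * d2 F (doubleMap y) * ((y.1⁻¹ : GL (Fin n) ℂ) : Mat n)) :
    leftDeriv (F ∘ doubleMap) y = (rPlus (-V) - W, rMinus (-V) - W) := by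
  have hp : IsTriangularPair (B : Mat n) C := by
    rw [hB, hC]; exact isTriangularPair_factors _
  obtain ⟨h1, h2⟩ := hp.r_conj (nabla1' F (doubleMap y))
  rw [rPlus_neg, rMinus_neg, hV, h1, h2, hW]
  exact gradientWrt_pairing2_eq (pairing2_leftDeriv hy hF hB hC)

/-- The right derivative of a pulled back function, decomposed along the diagonal and the dual
subspace. Here `p`, `q`, `q'` are `∇₁F`, `∇₂F`, `∇₂'F`; the dual component is the one of
`-(p + q - q')`. -/
theorem rightDeriv_comp_doubleMap (hy : y ∈ doubleSource n)
    (hF : DifferentiableAt ℝ (coordFn F) (emb (doubleMap y)))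
    (hB : (B : Mat n) = upperFactor ((y.1 * y.2⁻¹ : GL (Fin n) ℂ) : Mat n))
    (hC : (C : Mat n) = lowerFactor ((y.1 * y.2⁻¹ : GL (Fin n) ℂ) : Mat n))
    (hBC : y.1 * y.2⁻¹ = B * C) {g : GL (Fin n) ℂ} (hg : g = y.1⁻¹ * B) {p q q' N : Mat n}
    (hp : p = (g : Mat n) * nabla1' F (doubleMap y) * ((g⁻¹ : GL (Fin n) ℂ) : Mat n))
    (hq : q = ((y.1⁻¹ * y.2 : GL (Fin n) ℂ) : Mat n) * d2 F (doubleMap y))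
    (hq' : q' = d2 F (doubleMap y) * ((y.1⁻¹ * y.2 : GL (Fin n) ℂ) : Mat n))
    (hN : N = (g : Mat n) * r (nabla1' F (doubleMap y)) * ((g⁻¹ : GL (Fin n) ℂ) : Mat n)) :
    rightDeriv (F ∘ doubleMap) y
      = (rPlus (-(p + q - q')) - (N + (1 / 2 : ℝ) • p + q - rPlus (p + q - q')),
        rMinus (-(p + q - q')) - (N + (1 / 2 : ℝ) • p + q - rPlus (p + q - q'))) := by
  rw [rightDeriv_eq (pairing2_leftDeriv hy hF hB hC)]
  have e1 : B = y.1 * g := by rw [hg]; group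
  have e2 : C = g⁻¹ * y.2⁻¹ := by
    rw [hg]
    calc C = B⁻¹ * (B * C) := by group
      _ = _ := by rw [← hBC]; group
  have hS : rPlus (p + q - q') = rMinus (p + q - q') + (p + q - q') :=
    sub_eq_iff_eq_add'.1 (rPlus_sub_rMinus _)
  have h1 : (g : Mat n) * rPlus (nabla1' F (doubleMap y)) * ((g⁻¹ : GL (Fin n) ℂ) : Mat n)
      = N + (1 / 2 : ℝ) • p := by
    rw [rPlus, mul_add, add_mul, hN, hp, mul_smul_comm, smul_mul_assoc]
  have h2 : (g : Mat n) * rMinus (nabla1' F (doubleMap y)) * ((g⁻¹ : GL (Fin n) ℂ) : Mat n)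
      = N - (1 / 2 : ℝ) • p := by
    rw [rMinus, mul_sub, sub_mul, hN, hp, mul_smul_comm, smul_mul_assoc]
  have c1 : ((y.1⁻¹ : GL (Fin n) ℂ) : Mat n) * (-((B : Mat n) * rPlus (nabla1' F (doubleMap y))
        * ((B⁻¹ : GL (Fin n) ℂ) : Mat n))
        - (y.2 : Mat n) * d2 F (doubleMap y) * ((y.1⁻¹ : GL (Fin n) ℂ) : Mat n)) * (y.1 : Mat n)
      = -(N + (1 / 2 : ℝ) • p) - q := by
    rw [← h1, hq, e1]
    simp [mul_inv_rev, mul_sub, sub_mul, mul_assoc]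
  have c2 : ((y.2⁻¹ : GL (Fin n) ℂ) : Mat n) * (-(((C⁻¹ : GL (Fin n) ℂ) : Mat n)
        * rMinus (nabla1' F (doubleMap y)) * (C : Mat n))
        - (y.2 : Mat n) * d2 F (doubleMap y) * ((y.1⁻¹ : GL (Fin n) ℂ) : Mat n)) * (y.2 : Mat n)
      = -(N - (1 / 2 : ℝ) • p) - q' := by
    rw [← h2, hq', e2]
    simp [mul_inv_rev, mul_sub, sub_mul, mul_assoc]
  rw [c1, c2, rPlus_neg, rMinus_neg]
  refine Prod.ext ?_ ?_
  · simp only; abel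
  · simp only [hS]; module

/-- The map `doubleMap` is Poisson. -/
theorem bracket2_comp_doubleMap (hy : y ∈ doubleSource n) {H : M n → ℝ}
    (hF : DifferentiableAt ℝ (coordFn F) (emb (doubleMap y)))
    (hH : DifferentiableAt ℝ (coordFn H) (emb (doubleMap y))) :
    bracket2 F H (doubleMap y) = heisenbergBracket (F ∘ doubleMap) (H ∘ doubleMap) y := by
  obtain ⟨B, C, hB, hC, hBC⟩ := exists_factors hy.1.1.1 hy.1.1.2
  replace hBC := (Units.ext hBC).symm
  have hg : (doubleMap y).1 = y.1⁻¹ * B := by rw [doubleMap, ← hB, toGL_coe]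
  have hp : ∀ {K : M n → ℝ}, DifferentiableAt ℝ (coordFn K) (emb (doubleMap y)) →
      nabla1 K (doubleMap y) = ((doubleMap y).1 : Mat n) * nabla1' K (doubleMap y)
        * (((doubleMap y).1⁻¹ : GL (Fin n) ℂ) : Mat n) := fun hK => by
    rw [nabla1_eq hK, nabla1'_eq hK]
    simp [mul_assoc]
  have hN : ∀ {K L : M n → ℝ}, DifferentiableAt ℝ (coordFn L) (emb (doubleMap y)) →
      pairing (((doubleMap y).1 : Mat n) * r (nabla1' K (doubleMap y))
        * (((doubleMap y).1⁻¹ : GL (Fin n) ℂ) : Mat n)) (nabla1 L (doubleMap y))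
      = pairing (r (nabla1' K (doubleMap y))) (nabla1' L (doubleMap y)) := fun hL => by
    rw [hp hL, mul_assoc, pairing_mul_cyclic, pairing_mul_left]
    simp [mul_assoc]
  have hplus : ∀ P : Mat n, ((doubleMap y).1 : Mat n) * rPlus P
        * (((doubleMap y).1⁻¹ : GL (Fin n) ℂ) : Mat n)
      = (doubleMap y).1 * r P * (((doubleMap y).1⁻¹ : GL (Fin n) ℂ) : Mat n)
        + (1 / 2 : ℝ) • (((doubleMap y).1 : Mat n) * P
          * (((doubleMap y).1⁻¹ : GL (Fin n) ℂ) : Mat n)) := fun P => by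
    rw [rPlus, mul_add, add_mul, mul_smul_comm, smul_mul_assoc]
  have hminus : ∀ P : Mat n, ((doubleMap y).1 : Mat n) * rMinus P
        * (((doubleMap y).1⁻¹ : GL (Fin n) ℂ) : Mat n)
      = (doubleMap y).1 * r P * (((doubleMap y).1⁻¹ : GL (Fin n) ℂ) : Mat n)
        - (1 / 2 : ℝ) • (((doubleMap y).1 : Mat n) * P
          * (((doubleMap y).1⁻¹ : GL (Fin n) ℂ) : Mat n)) := fun P => by
    rw [rMinus, mul_sub, sub_mul, mul_smul_comm, smul_mul_assoc]
  rw [heisenbergBracket, leftDeriv_comp_doubleMap hy hF hB hC rfl rfl,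
    leftDeriv_comp_doubleMap hy hH hB hC rfl rfl,
    rightDeriv_comp_doubleMap hy hF hB hC hBC hg rfl rfl rfl rfl,
    rightDeriv_comp_doubleMap hy hH hB hC hBC hg rfl rfl rfl rfl, pairing2_rho, pairing2_rho,
    pairing_neg_left, pairing_neg_right, pairing_comm (_ * d2 F (doubleMap y) * _),
    pairing_leftDeriv hBC hg, pairing_leftDeriv hBC hg, hplus, hplus, hminus, hminus, ← hp hF,
    ← hp hH]
  -- both sides are now expressed by the derivatives of `F` and `H` at `doubleMap y`
  have key := bracket_identity (pairing_mul_mul_swap ((y.1⁻¹ * y.2 : GL (Fin n) ℂ) : Mat n)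
    (d2 F (doubleMap y)) (d2 H (doubleMap y))) (hN hH) (hN hF)
  refine Eq.trans ?_ (key.symm.trans ?_)
  · rfl
  · ring

end Compare

end BiHam

end

theorem theorem2p1 (n : ℕ) :
    -- the derivatives entering the formulae exist and are given by their defining relations
    (∀ (F : BiHam.SmoothFn n) (g : GL (Fin n) ℂ) (J X : BiHam.Mat n),
      HasDerivAt (fun t : ℝ => F (BiHam.expGL (t • X) * g, J))
        (BiHam.pairing (BiHam.nabla1 F (g, J)) X) 0 ∧
      HasDerivAt (fun t : ℝ => F (g * BiHam.expGL (t • X), J))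
        (BiHam.pairing (BiHam.nabla1' F (g, J)) X) 0 ∧
      HasDerivAt (fun t : ℝ => F (g, J + t • X))
        (BiHam.pairing (BiHam.d2 F (g, J)) X) 0) ∧
    -- the two formulae define Poisson brackets on the algebra of smooth functions
    (∃ B : BiHam.SmoothFn n →ₗ[ℝ] BiHam.SmoothFn n →ₗ[ℝ] BiHam.SmoothFn n,
      (∀ F H x, B F H x = BiHam.bracket1 F H x) ∧ BiHam.IsPoissonBracket B) ∧
    (∃ B : BiHam.SmoothFn n →ₗ[ℝ] BiHam.SmoothFn n →ₗ[ℝ] BiHam.SmoothFn n,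
      (∀ F H x, B F H x = BiHam.bracket2 F H x) ∧ BiHam.IsPoissonBracket B) ∧
    -- right trivialization identifies the first bracket with the canonical cotangent bracket
    (∃ Φ : BiHam.M n ≃ₘ^∞⟮BiHam.IM n, BiHam.ICot n⟯ BiHam.CotangentGL n,
      (∀ (g : GL (Fin n) ℂ) (J : BiHam.Mat n), (Φ (g, J)).1 = g ∧
        ∀ v : BiHam.Mat n, (Φ (g, J)).2 v =
          BiHam.pairing J (v * ((g⁻¹ : GL (Fin n) ℂ) : BiHam.Mat n))) ∧
      ∀ (f h : C^∞⟮BiHam.ICot n, BiHam.CotangentGL n; ℝ⟯) (x : BiHam.M n),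
        BiHam.bracket1 (f ∘ Φ) (h ∘ Φ) x = BiHam.canonicalBracket f h (Φ x)) ∧
    -- the second bracket is quadratic in the linear coordinates
    (∀ φ χ : BiHam.Mat n × BiHam.Mat n →ₗ[ℝ] ℝ,
      ∃ Q : QuadraticForm ℝ (BiHam.Mat n × BiHam.Mat n), ∀ x : BiHam.M n,
        BiHam.bracket2 (fun y => φ ((y.1 : BiHam.Mat n), y.2))
          (fun y => χ ((y.1 : BiHam.Mat n), y.2)) x = Q ((x.1 : BiHam.Mat n), x.2)) ∧
    -- near the identity, the second bracket is the transferred Heisenberg double bracket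
    (∃ ψ : OpenPartialHomeomorph (GL (Fin n) ℂ × GL (Fin n) ℂ) (BiHam.M n),
      (1, 1) ∈ ψ.source ∧ ψ (1, 1) = (1, 1) ∧
      ContMDiffOn (𝓘(ℝ, BiHam.Mat n).prod 𝓘(ℝ, BiHam.Mat n)) (BiHam.IM n) ∞ ψ ψ.source ∧
      ContMDiffOn (BiHam.IM n) (𝓘(ℝ, BiHam.Mat n).prod 𝓘(ℝ, BiHam.Mat n)) ∞ ψ.symm ψ.target ∧
      (∀ y ∈ ψ.source, BiHam.FactorRel y (ψ y)) ∧
      ∀ F H : BiHam.M n → ℝ,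
        ContMDiffOn (BiHam.IM n) 𝓘(ℝ, ℝ) ∞ F ψ.target →
        ContMDiffOn (BiHam.IM n) 𝓘(ℝ, ℝ) ∞ H ψ.target →
        ∀ y ∈ ψ.source,
          BiHam.bracket2 F H (ψ y) = BiHam.heisenbergBracket (F ∘ ψ) (H ∘ ψ) y) := by
  have hd : ∀ {F : BiHam.M n → ℝ},
      ContMDiffOn (BiHam.IM n) 𝓘(ℝ, ℝ) ∞ F (BiHam.doubleHomeo n).target →
      ∀ y ∈ (BiHam.doubleHomeo n).source,
        DifferentiableAt ℝ (BiHam.coordFn F) (BiHam.emb (BiHam.doubleMap y)) := fun hF y hy =>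
    have hx := (BiHam.doubleMap_spec hy).1
    (BiHam.contDiffAt_coordFn ((hF _ hx).contMDiffAt
      (BiHam.isOpen_doubleTarget.mem_nhds hx))).differentiableAt (by simp)
  refine ⟨fun F g J X => ?_, ?_, ?_, ?_, BiHam.bracket2_linear, ?_⟩
  · have hF := BiHam.SmoothFn.differentiableAt_coord F (g, J)
    rw [BiHam.nabla1_eq hF, BiHam.nabla1'_eq hF, BiHam.d2_eq hF]
    exact ⟨BiHam.hasDerivAt_left hF X, BiHam.hasDerivAt_right hF X, BiHam.hasDerivAt_add hF X⟩
  · exact ⟨BiHam.tensorBracket BiHam.tensor1 BiHam.isPoissonTensor1.smooth,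
      fun F H x => (BiHam.bracket1_eq (BiHam.SmoothFn.differentiableAt_coord F x)
        (BiHam.SmoothFn.differentiableAt_coord H x)).symm,
      BiHam.isPoissonTensor1.isPoissonBracket⟩
  · exact ⟨BiHam.tensorBracket BiHam.tensor2 BiHam.isPoissonTensor2.smooth,
      fun F H x => (BiHam.bracket2_eq (BiHam.SmoothFn.differentiableAt_coord F x)
        (BiHam.SmoothFn.differentiableAt_coord H x)).symm,
      BiHam.isPoissonTensor2.isPoissonBracket⟩
  · exact ⟨BiHam.trivialization, fun g J => ⟨rfl, BiHam.trivialization_snd g J⟩,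
      BiHam.bracket1_comp_trivialization⟩
  · exact ⟨BiHam.doubleHomeo n, BiHam.one_mem_doubleSource, BiHam.doubleMap_one,
      BiHam.contMDiffOn_doubleMap, BiHam.contMDiffOn_doubleMapInv,
      fun y hy => BiHam.factorRel_doubleMap hy,
      fun F H hF hH y hy => BiHam.bracket2_comp_doubleMap hy (hd hF y hy) (hd hH y hy)⟩
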